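/- Let $K$ be an algebraically closed field of characteristic $p \ge 0$ with $p \ne 2, 3$. For an irreducible plane curve $C \subset \mathbb{P}^2$ over $K$, a point $P \in C$ is called an (inner) Galois point if the function field extension $K(C)/\pi_P^{*}K(\mathbb{P}^1)$ induced by the projection $\pi_P : C \dashrightarrow \mathbb{P}^1$ from $P$ is Galois. Let $\delta_0(C)$ (resp. $\delta_2(C)$) be the number of Galois points $P$ of $C$ which are smooth points of $C$ with $I_P(C, T_PC) = 2$ (resp. $I_P(C, T_PC) = 4$), where $I_P(C, T_PC)$ is the intersection multiplicity at $P$ of $C$ and its tangent line $T_PC$ at $P$. Then there is no irreducible rational plane curve $C$ of degree four over $K$ with both $\delta_0(C) \ge 1$ and $\delta_2(C) \ge 1$. -/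

import Mathlib

open scoped LinearAlgebra.Projectivization

noncomputable section

/-- An irreducible plane curve of degree `d` over `K`, given by an irreducible homogeneous
polynomial of degree `d` in three variables. -/
structure PlaneCurve (K : Type*) [Field K] (d : ℕ) where
  /-- the defining form -/
  form : MvPolynomial (Fin 3) K
  isHomogeneous : form.IsHomogeneous d
  irreducible : Irreducible form

namespace PlaneCurve

variable {K : Type*} [Field K] {d : ℕ}

/-- The homogeneous coordinate ring `K[X, Y, Z] / (F)`. -/
abbrev CoordRing (C : PlaneCurve K d) : Type _ :=
  MvPolynomial (Fin 3) K ⧸ Ideal.span {C.form}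

instance instIsDomainCoordRing (C : PlaneCurve K d) : IsDomain C.CoordRing := by
  have : (Ideal.span {C.form}).IsPrime :=
    (Ideal.span_singleton_prime C.irreducible.ne_zero).2 C.irreducible.prime
  exact Ideal.Quotient.isDomain _

/-- The class of a polynomial in the fraction field of the homogeneous coordinate ring. -/
def toFrac (C : PlaneCurve K d) : MvPolynomial (Fin 3) K →ₐ[K] FractionRing C.CoordRing :=
  (IsScalarTower.toAlgHom K C.CoordRing (FractionRing C.CoordRing)).comp
    (Ideal.Quotient.mkₐ K (Ideal.span {C.form}))

/-- The function field `K(C)`: the fractions `g / h` of forms of the same degree, with `h` not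
vanishing identically on the curve. -/
def functionField (C : PlaneCurve K d) : IntermediateField K (FractionRing C.CoordRing) where
  carrier := {z | ∃ (n : ℕ) (g h : MvPolynomial (Fin 3) K), g.IsHomogeneous n ∧
    h.IsHomogeneous n ∧ C.toFrac h ≠ 0 ∧ z = C.toFrac g / C.toFrac h}
  mul_mem' := by
    rintro _ _ ⟨n, g, h, hg, hh, h0, rfl⟩ ⟨n', g', h', hg', hh', h0', rfl⟩
    refine ⟨n + n', g * g', h * h', hg.mul hg', hh.mul hh', ?_, ?_⟩
    · rw [map_mul]; exact mul_ne_zero h0 h0'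
    · rw [map_mul, map_mul, div_mul_div_comm]
  add_mem' := by
    rintro _ _ ⟨n, g, h, hg, hh, h0, rfl⟩ ⟨n', g', h', hg', hh', h0', rfl⟩
    refine ⟨n + n', g * h' + h * g', h * h', (hg.mul hh').add (hh.mul hg'), hh.mul hh', ?_, ?_⟩
    · rw [map_mul]; exact mul_ne_zero h0 h0'
    · rw [map_mul, map_add, map_mul, map_mul, div_add_div _ _ h0 h0']
  algebraMap_mem' := by
    intro r
    refine ⟨0, MvPolynomial.C r, 1, MvPolynomial.isHomogeneous_C _ _,
      MvPolynomial.isHomogeneous_one _ _, ?_, ?_⟩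
    · rw [map_one]; exact one_ne_zero
    · rw [map_one, div_one, ← MvPolynomial.algebraMap_eq, AlgHom.commutes]
  inv_mem' := by
    rintro _ ⟨n, g, h, hg, hh, h0, rfl⟩
    by_cases g0 : C.toFrac g = 0
    · exact ⟨n, g, h, hg, hh, h0, by simp [g0]⟩
    · exact ⟨n, h, g, hh, hg, g0, by rw [inv_div]⟩

/-- The curve is rational: its function field is a rational function field in one variable
over `K`. -/
def IsRational (C : PlaneCurve K d) : Prop :=
  Nonempty (C.functionField ≃ₐ[K] RatFunc K)

/-- The subfield `π_P^* K(ℙ¹)` of `K(C)`, for the projection `π_P` from the point `P`. If `l, m`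
is a basis of the linear forms vanishing at `P`, then `π_P = (l : m)`, and the subfield is
`K(l / m)`; here all quotients of linear forms vanishing at `P` are used as generators, so that
no basis has to be chosen. -/
def projectionField (C : PlaneCurve K d) (P : ℙ K (Fin 3 → K)) :
    IntermediateField K C.functionField :=
  IntermediateField.adjoin K {z | ∃ l m : MvPolynomial (Fin 3) K,
    l.IsHomogeneous 1 ∧ m.IsHomogeneous 1 ∧
    MvPolynomial.eval P.rep l = 0 ∧ MvPolynomial.eval P.rep m = 0 ∧ C.toFrac m ≠ 0 ∧
    (z : FractionRing C.CoordRing) = C.toFrac l / C.toFrac m}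

/-- The point `P` lies on the curve. -/
def HasPoint (C : PlaneCurve K d) (P : ℙ K (Fin 3 → K)) : Prop :=
  MvPolynomial.eval P.rep C.form = 0

/-- The point `P` lies on the curve and is a smooth point of it. -/
def IsSmoothPoint (C : PlaneCurve K d) (P : ℙ K (Fin 3 → K)) : Prop :=
  C.HasPoint P ∧ ∃ i, MvPolynomial.eval P.rep (MvPolynomial.pderiv i C.form) ≠ 0

/-- The point `P` of the curve is an (inner) Galois point: `K(C) / π_P^* K(ℙ¹)` is Galois. -/
def IsGaloisPoint (C : PlaneCurve K d) (P : ℙ K (Fin 3 → K)) : Prop :=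
  C.HasPoint P ∧ IsGalois (C.projectionField P) C.functionField

/-- The projective tangent line at a smooth point `P`, as a set of vectors of `K³`. -/
def tangentLine (C : PlaneCurve K d) (P : ℙ K (Fin 3 → K)) : Set (Fin 3 → K) :=
  {v | ∑ i, MvPolynomial.eval P.rep (MvPolynomial.pderiv i C.form) * v i = 0}

/-- The restriction `F(a + t v)` of the defining form to the line through `a` and `v`, as a
polynomial in the parameter `t`. -/
def restrict (C : PlaneCurve K d) (a v : Fin 3 → K) : Polynomial K :=
  MvPolynomial.aeval (fun i => Polynomial.C (a i) + Polynomial.C (v i) * Polynomial.X) C.form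

/-- For linearly independent `a, v`, the intersection multiplicity at `a` of the curve and the
line through `a` and `v`: the order of vanishing of `F(a + t v)` at `t = 0` (it is `⊤` if the
line is contained in the curve). -/
def lineMultiplicity (C : PlaneCurve K d) (a v : Fin 3 → K) : ℕ∞ :=
  emultiplicity Polynomial.X (C.restrict a v)

/-- The intersection multiplicity `I_P(C, T_P C)` of the curve and its tangent line at a smooth
point `P`. All vectors `v` of the tangent line that are not multiples of `P` give the same value,
see `lineMultiplicity_eq`, so that the infimum is just this common value. -/
def tangentMultiplicity (C : PlaneCurve K d) (P : ℙ K (Fin 3 → K)) : ℕ∞ :=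
  ⨅ v ∈ {v | v ∈ C.tangentLine P ∧ v ∉ Submodule.span K {P.rep}}, C.lineMultiplicity P.rep v

theorem lineMultiplicity_le (C : PlaneCurve K d) (a v : Fin 3 → K) (b c : K) :
    C.lineMultiplicity a v ≤ C.lineMultiplicity a (b • a + c • v) := by
  refine emultiplicity_le_emultiplicity_iff.2 fun n hn => ?_
  have hmap : ∀ (w : Fin 3 → K) (s : PowerSeries K), Polynomial.aeval s (C.restrict a w) =
      MvPolynomial.aeval (fun i => PowerSeries.C (a i) + PowerSeries.C (w i) * s) C.form := by
    intro w s
    rw [restrict, ← AlgHom.comp_apply, MvPolynomial.comp_aeval]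
    simp [Polynomial.aeval_C]
  have hhom : ∀ (u : PowerSeries K) (f : Fin 3 → PowerSeries K),
      MvPolynomial.aeval (fun i => u * f i) C.form = u ^ d * MvPolynomial.aeval f C.form := by
    intro u f
    simp only [MvPolynomial.aeval_def, MvPolynomial.eval₂_eq, Finset.mul_sum]
    refine Finset.sum_congr rfl fun m hm => ?_
    have hdeg : ∑ i, m i = d := by
      have := C.isHomogeneous (MvPolynomial.mem_support_iff.1 hm)
      rw [← this, Finsupp.weight_apply, Finsupp.sum_fintype _ _ (by simp)]
      simp
    have hsupp : ∏ i ∈ m.support, u ^ m i = u ^ d := by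
      rw [Finset.prod_pow_eq_pow_sum, ← hdeg]
      congr 1
      exact Finset.sum_subset (Finset.subset_univ _) (by simp)
    simp only [mul_pow, Finset.prod_mul_distrib, hsupp]
    ring
  obtain ⟨u, hu0⟩ : ∃ u : PowerSeries K, u = 1 + PowerSeries.C b * PowerSeries.X := ⟨_, rfl⟩
  have hu : u * u⁻¹ = 1 := PowerSeries.mul_inv_cancel _ (by simp [hu0])
  have key : Polynomial.aeval (PowerSeries.X : PowerSeries K) (C.restrict a (b • a + c • v)) =
      u ^ d * Polynomial.aeval (PowerSeries.X * (PowerSeries.C c * u⁻¹)) (C.restrict a v) := by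
    rw [hmap, hmap, ← hhom]
    congr 2
    funext i
    have : u * (PowerSeries.C (a i) + PowerSeries.C (v i) *
        (PowerSeries.X * (PowerSeries.C c * u⁻¹))) = u * PowerSeries.C (a i) +
          PowerSeries.C (v i) * PowerSeries.X * PowerSeries.C c * (u * u⁻¹) := by ring
    rw [this, hu, hu0]
    simp only [Pi.add_apply, Pi.smul_apply, smul_eq_mul, map_add, map_mul]
    ring
  have hdvd : (PowerSeries.X : PowerSeries K) ^ n ∣
      (C.restrict a (b • a + c • v) : PowerSeries K) := by
    have hcoe : ∀ q : Polynomial K,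
        Polynomial.aeval (PowerSeries.X : PowerSeries K) q = (q : PowerSeries K) := by
      intro q
      induction q using Polynomial.induction_on' with
      | add p q hp hq => rw [map_add, hp, hq, Polynomial.coe_add]
      | monomial k r =>
        rw [Polynomial.aeval_monomial, PowerSeries.algebraMap_apply, Polynomial.coe_monomial,
          Algebra.algebraMap_self, RingHom.id_apply]
        ext j
        rw [PowerSeries.coeff_C_mul, PowerSeries.coeff_X_pow, PowerSeries.coeff_monomial]
        simp
    rw [← hcoe, key]
    obtain ⟨q, hq⟩ := hn
    rw [hq, map_mul, map_pow, Polynomial.aeval_X, mul_pow, mul_assoc]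
    exact (Dvd.intro _ rfl).mul_left _
  rw [Polynomial.X_pow_dvd_iff]
  intro m hm
  simpa using PowerSeries.X_pow_dvd_iff.1 hdvd m hm

/-- The intersection multiplicity does not depend on the choice of a second point on the line. -/
theorem lineMultiplicity_eq (C : PlaneCurve K d) (a v : Fin 3 → K) (b c : K) (hc : c ≠ 0) :
    C.lineMultiplicity a (b • a + c • v) = C.lineMultiplicity a v := by
  refine le_antisymm ?_ (C.lineMultiplicity_le a v b c)
  refine (C.lineMultiplicity_le a (b • a + c • v) (-(c⁻¹ * b)) c⁻¹).trans_eq ?_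
  congr 1
  rw [smul_add, smul_smul, smul_smul, inv_mul_cancel₀ hc, one_smul, neg_smul, neg_add_cancel_left]

/-- The number `δ₀(C)` of Galois points `P` that are smooth points of `C` with
`I_P(C, T_P C) = 2`. -/
def deltaZero (C : PlaneCurve K d) : ℕ∞ :=
  {P | C.IsSmoothPoint P ∧ C.IsGaloisPoint P ∧ C.tangentMultiplicity P = 2}.encard

/-- The number `δ₂(C)` of Galois points `P` that are smooth points of `C` with
`I_P(C, T_P C) = 4`. -/
def deltaTwo (C : PlaneCurve K d) : ℕ∞ :=
  {P | C.IsSmoothPoint P ∧ C.IsGaloisPoint P ∧ C.tangentMultiplicity P = 4}.encard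

end PlaneCurve

end

/-!
Let `P` be the total flex and `P'` the ordinary smooth Galois point, and identify the function field
of the curve `C` with `K(X)`. The vector of coordinate functions is then a generic point of `C`
with coordinates in `K(X)` (`IsGenericPoint`), and the projection from a smooth point is a ratio
`u ∈ K(X)` of two of its coordinates with `[K(X) : K(u)] = 3` (`finrank_adjoin_eq_three`).

If `K(X) / K(u)` is Galois, its group is generated by an automorphism of order three of the
projective line. In characteristic different from three this automorphism is diagonalizable, so
that after a change of parameter `u` is a Möbius transform of `X ^ 3`
(`RatFunc.exists_algEquiv_eq_cube_moebius`).

At the total flex `P`, comparing pole orders in the cubic equation of the third coordinate over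
`K(u)` shows that the tangent direction is one of the two branch points. Hence `C` is parametrized
by the net of quartics spanned by `X ^ 3`, `1` and one polynomial `q` of degree four
(`exists_parametrization`).

At the second point `P'`, the lines through it cut out a pencil in this net, and the pencil has the
shape `⟨N L ^ 3, N M ^ 3⟩` with `N, L, M` affine functions (`exists_cubes`); here `N` is not
constant because `P' ≠ P`. All members of the net have proportional vectors of coefficients at `X`,
`X ^ 2` and `X ^ 4`, and this forces `N` to be proportional to `L` or to `M`
(`eq_or_eq_of_coeffs`). In that case the tangent line at `P'` meets `C` more than twice there
(`false_of_common_root`), contrary to the assumption on `P'`.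
-/

section

open IntermediateField

namespace RatFunc

variable {K : Type*} [Field K]

/-! ### Automorphisms and cyclic cubic subfields of the rational function field -/

theorem ne_C_of_adjoin_eq_top {s : RatFunc K} (hs : K⟮s⟯ = ⊤) : ¬ ∃ c, s = C c := by
  intro h
  rw [eq_C_iff] at h
  have := finrank_eq_max_natDegree s
  rw [hs, IntermediateField.finrank_top, h.1, h.2] at this
  simp at this

theorem max_natDegree_of_adjoin_eq_top {s : RatFunc K} (hs : K⟮s⟯ = ⊤) :
    max s.num.natDegree s.denom.natDegree = 1 := by
  rw [← finrank_eq_max_natDegree, hs, IntermediateField.finrank_top]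

theorem adjoin_algEquiv_X (θ : RatFunc K ≃ₐ[K] RatFunc K) : K⟮θ X⟯ = ⊤ := by
  have := IntermediateField.adjoin_map K {(X : RatFunc K)} (θ : RatFunc K →ₐ[K] RatFunc K)
  rw [adjoin_X, Set.image_singleton] at this
  rw [show θ X = (θ : RatFunc K →ₐ[K] RatFunc K) X from rfl, ← this, ← AlgHom.fieldRange_eq_map]
  exact AlgHom.fieldRange_eq_top.2 θ.surjective

theorem exists_algEquiv_X_eq {s : RatFunc K} (hs : K⟮s⟯ = ⊤) :
    ∃ θ : RatFunc K ≃ₐ[K] RatFunc K, θ X = s := by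
  have htr : Function.Injective (Polynomial.aeval (R := K) s) :=
    transcendental_iff_injective.1 (transcendental_of_ne_C s (ne_C_of_adjoin_eq_top hs))
  let φ : RatFunc K →ₐ[K] RatFunc K := liftAlgHom (Polynomial.aeval s)
    (nonZeroDivisors_le_comap_nonZeroDivisors_of_injective _ htr)
  have hφ : φ X = s := by
    have := liftAlgHom_apply_div' (L := RatFunc K) (Polynomial.aeval s)
      (nonZeroDivisors_le_comap_nonZeroDivisors_of_injective _ htr) Polynomial.X 1
    simpa [φ] using this
  refine ⟨AlgEquiv.ofBijective φ ⟨φ.toRingHom.injective, ?_⟩, hφ⟩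
  rw [← AlgHom.fieldRange_eq_top, eq_top_iff, ← hs, adjoin_simple_le_iff]
  exact ⟨X, hφ⟩

theorem finrank_adjoin_algEquiv (θ : RatFunc K ≃ₐ[K] RatFunc K) (u : RatFunc K) :
    Module.finrank K⟮θ u⟯ (RatFunc K) = Module.finrank K⟮u⟯ (RatFunc K) := by
  have h : (K⟮u⟯).map (θ : RatFunc K →ₐ[K] RatFunc K) = K⟮θ u⟯ := by
    rw [IntermediateField.adjoin_map, Set.image_singleton]; rfl
  rw [← h]
  exact (Algebra.finrank_eq_of_equiv_equiv
    (IntermediateField.intermediateFieldMap θ K⟮u⟯).toRingEquiv θ.toRingEquiv (by ext; rfl)).symm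

theorem algEquiv_algebraMap (θ : RatFunc K →ₐ[K] RatFunc K) (p : Polynomial K) :
    θ (algebraMap _ _ p) = Polynomial.aeval (θ X) p := by
  rw [← aeval_X_left_eq_algebraMap, Polynomial.aeval_algHom_apply]

@[simp]
theorem algEquiv_C (θ : RatFunc K ≃ₐ[K] RatFunc K) (a : K) : θ (C a) = C a :=
  θ.commutes a

/-- An automorphism of `K(X)` is a Möbius transformation of the parameter; moving one of its fixed
points to `∞` makes it affine. -/
theorem exists_affine_of_algEquiv [IsAlgClosed K] (σ : RatFunc K ≃ₐ[K] RatFunc K) :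
    ∃ s : RatFunc K, K⟮s⟯ = ⊤ ∧ ∃ a b : K, σ s = C a * s + C b := by
  have htop := adjoin_algEquiv_X σ
  have hmax := max_natDegree_of_adjoin_eq_top htop
  obtain ⟨a, b, hab⟩ := Polynomial.exists_eq_X_add_C_of_natDegree_le_one
    ((le_max_left _ _).trans hmax.le)
  obtain ⟨c, d, hcd⟩ := Polynomial.exists_eq_X_add_C_of_natDegree_le_one
    ((le_max_right _ _).trans hmax.le)
  have hσ : σ X * (C c * X + C d) = C a * X + C b := by
    have h1 := num_div_denom (σ X)
    rw [div_eq_iff (algebraMap_ne_zero (denom_ne_zero _))] at h1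
    rw [hab, hcd] at h1
    simpa using h1.symm
  have hden : C c * X + C d ≠ 0 := by
    have := algebraMap_ne_zero (denom_ne_zero (σ X))
    rw [hcd] at this
    simpa using this
  by_cases hc : c = 0
  · refine ⟨X, adjoin_X, a / d, b / d, ?_⟩
    have hd : C d ≠ 0 := by simpa [hc] using hden
    rw [hc, map_zero, zero_mul, zero_add] at hσ
    rw [map_div₀, map_div₀]
    field_simp
    exact hσ
  -- `τ` is a finite fixed point of the Möbius transformation, and `(X - τ)⁻¹` moves it to `∞`
  · obtain ⟨τ, hτ⟩ := IsAlgClosed.exists_root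
      (Polynomial.C c * Polynomial.X ^ 2 + Polynomial.C (d - a) * Polynomial.X + Polynomial.C (-b))
      (by rw [Polynomial.degree_quadratic hc]; decide)
    have hτ' : c * τ ^ 2 + (d - a) * τ + -b = 0 := by simpa [Polynomial.IsRoot] using hτ
    have hX : ∀ r : K, X - C r ≠ 0 := by
      intro r hr
      exact ne_C_of_adjoin_eq_top adjoin_X ⟨r, sub_eq_zero.1 hr⟩
    have hac : a - c * τ ≠ 0 := by
      intro h
      have hb : b = d * τ := by linear_combination -hτ' - τ * h
      have ha : a = c * τ := by linear_combination h
      have h0 : (σ X - C τ) * (C c * X + C d) = 0 := by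
        rw [sub_mul, hσ, hb, ha, map_mul, map_mul]
        ring
      have h1 : σ (X - C τ) = 0 := by
        rw [map_sub, algEquiv_C]
        exact (mul_eq_zero.1 h0).resolve_right hden
      exact hX τ (σ.injective (h1.trans (map_zero σ).symm))
    refine ⟨(X - C τ)⁻¹, ?_, (d + c * τ) / (a - c * τ), c / (a - c * τ), ?_⟩
    · obtain ⟨s, hs⟩ : ∃ s, s = (X - C τ)⁻¹ := ⟨_, rfl⟩
      have hXs : (X : RatFunc K) = s⁻¹ + C τ := by rw [hs, inv_inv]; ring
      rw [← hs, eq_top_iff, ← adjoin_X, adjoin_simple_le_iff, hXs]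
      exact add_mem (inv_mem (mem_adjoin_simple_self K s))
        (IntermediateField.algebraMap_mem K⟮s⟯ τ)
    · have h1 : (σ X - C τ) * (C c * X + C d) = C (a - c * τ) * (X - C τ) := by
        rw [sub_mul, hσ]
        have hb : b = c * τ ^ 2 + (d - a) * τ := by linear_combination -hτ'
        rw [hb]
        simp only [map_sub, map_mul, map_add, map_pow]
        ring
      have hC : C (a - c * τ) ≠ 0 := (map_ne_zero C).2 hac
      have h0 : σ X - C τ ≠ 0 := by
        intro h
        rw [h, zero_mul] at h1
        exact mul_ne_zero hC (hX τ) h1.symm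
      rw [map_inv₀, map_sub, algEquiv_C, map_div₀, map_div₀]
      have hXτ := hX τ
      field_simp
      rw [← h1]
      simp only [map_add, map_mul]
      ring

/-- An automorphism of order three of `K(X)` is diagonalizable outside characteristic three, where
no translation has order three. -/
theorem exists_scaling_of_algEquiv [IsAlgClosed K] (h3 : (3 : K) ≠ 0)
    (σ : RatFunc K ≃ₐ[K] RatFunc K) (h1 : σ ≠ 1) (hσ : σ ^ 3 = 1) :
    ∃ s : RatFunc K, K⟮s⟯ = ⊤ ∧ ∃ ω : K, ω ^ 3 = 1 ∧ ω ≠ 1 ∧ σ s = C ω * s := by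
  obtain ⟨s, hs, a, b, hab⟩ := exists_affine_of_algEquiv σ
  have hconst := ne_C_of_adjoin_eq_top hs
  have h : σ (σ (σ s)) = s := by
    have := congrArg (fun f : RatFunc K ≃ₐ[K] RatFunc K => f s) hσ
    simpa [pow_succ] using this
  simp only [hab, map_add, map_mul, algEquiv_C] at h
  have ha3 : a ^ 3 = 1 := by
    by_contra hne
    have h0 : C (a ^ 3 - 1) ≠ 0 := (map_ne_zero C).2 (sub_ne_zero.2 hne)
    refine hconst ⟨-(a ^ 2 + a + 1) * b / (a ^ 3 - 1), ?_⟩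
    rw [map_div₀, eq_div_iff h0]
    simp only [map_sub, map_mul, map_add, map_pow, map_one, map_neg]
    linear_combination h
  have ha1 : a ≠ 1 := by
    rintro rfl
    have hb : b = 0 := by
      have : C (3 * b) = 0 := by
        simp only [map_mul, map_one, map_ofNat] at h ⊢
        linear_combination h
      simpa [h3] using this
    apply h1
    have hfix : ∀ z ∈ K⟮s⟯, σ z = z := by
      intro z hz
      induction hz using IntermediateField.adjoin_induction with
      | mem x hx =>
        rw [Set.mem_singleton_iff] at hx
        rw [hx, hab, hb]; simp
      | algebraMap x => exact σ.commutes x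
      | add x y _ _ hx hy => rw [map_add, hx, hy]
      | inv x _ hx => rw [map_inv₀, hx]
      | mul x y _ _ hx hy => rw [map_mul, hx, hy]
    ext z
    exact hfix z (hs ▸ IntermediateField.mem_top)
  have hC : C a - 1 ≠ 0 := by
    rw [← map_one C, ← map_sub]
    exact (map_ne_zero C).2 (sub_ne_zero.2 ha1)
  refine ⟨s + C (b / (a - 1)), ?_, a, ha3, ha1, ?_⟩
  · rw [eq_top_iff, ← hs, adjoin_simple_le_iff]
    have : s = (s + C (b / (a - 1))) - C (b / (a - 1)) := by ring
    nth_rw 2 [this]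
    exact sub_mem (mem_adjoin_simple_self K _)
      (IntermediateField.algebraMap_mem K⟮s + C (b / (a - 1))⟯ _)
  · rw [map_add, hab, algEquiv_C, map_div₀, map_sub, map_one]
    field_simp
    ring

/-- A rational function of degree three that is invariant under `X ↦ ω X`, for a primitive cube
root of unity `ω`, is a Möbius transform of `X ^ 3`. -/
theorem eq_cube_moebius {u : RatFunc K} {σ : RatFunc K ≃ₐ[K] RatFunc K} {ω : K}
    (hω3 : ω ^ 3 = 1) (hω : ω ≠ 1) (hσ : σ X = C ω * X) (hu : σ u = u)
    (hdeg : max u.num.natDegree u.denom.natDegree = 3) :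
    ∃ α β γ δ : K, α * δ - β * γ ≠ 0 ∧
      u * (C γ * X ^ 3 + C δ) = C α * X ^ 3 + C β := by
  have hω0 : ω ≠ 0 := by rintro rfl; simp at hω3
  have hω2 : ω ^ 2 ≠ 1 := by
    intro h; apply hω
    calc ω = ω ^ 3 := by rw [pow_succ, h, one_mul]
      _ = 1 := hω3
  obtain ⟨f, hf⟩ : ∃ f, f = u.num := ⟨_, rfl⟩
  obtain ⟨g, hg⟩ : ∃ g, g = u.denom := ⟨_, rfl⟩
  have hcop : IsCoprime f g := by rw [hf, hg]; exact isCoprime_num_denom u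
  have hg0 : g ≠ 0 := hg ▸ denom_ne_zero u
  have hufg : u * algebraMap _ _ g = algebraMap _ _ f := by
    rw [← eq_div_iff (algebraMap_ne_zero hg0), hf, hg, num_div_denom]
  rw [← hf, ← hg] at hdeg
  have hσp : ∀ p : Polynomial K, σ (algebraMap _ _ p) =
      algebraMap _ _ (p.comp (Polynomial.C ω * Polynomial.X)) := by
    intro p
    have := algEquiv_algebraMap (σ : RatFunc K →ₐ[K] RatFunc K) p
    rw [show (σ : RatFunc K →ₐ[K] RatFunc K) X = σ X from rfl, hσ] at this
    refine this.trans ?_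
    rw [← aeval_X_left_eq_algebraMap, Polynomial.aeval_comp]
    simp
  have hfg : f.comp (Polynomial.C ω * Polynomial.X) * g =
      f * g.comp (Polynomial.C ω * Polynomial.X) := by
    apply algebraMap_injective K
    rw [map_mul, map_mul, ← hσp, ← hσp, ← hufg, map_mul, hu]
    ring
  have hcompdeg : ∀ p : Polynomial K,
      (p.comp (Polynomial.C ω * Polynomial.X)).natDegree = p.natDegree := by
    intro p
    rw [Polynomial.natDegree_comp, Polynomial.natDegree_C_mul_X _ hω0, mul_one]
  have hscale : ∀ p q : Polynomial K, IsCoprime p q →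
      p.comp (Polynomial.C ω * Polynomial.X) * q = p * q.comp (Polynomial.C ω * Polynomial.X) →
      ∃ μ : K, p.comp (Polynomial.C ω * Polynomial.X) = Polynomial.C μ * p := by
    intro p q hpq h
    have hdvd : p ∣ p.comp (Polynomial.C ω * Polynomial.X) :=
      hpq.dvd_of_dvd_mul_right (h ▸ Dvd.intro _ rfl)
    obtain ⟨r, hr⟩ := hdvd
    by_cases hp : p = 0
    · exact ⟨0, by simp [hp]⟩
    have hr0 : r ≠ 0 := by
      rintro rfl
      rw [mul_zero, Polynomial.comp_eq_zero_iff] at hr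
      rcases hr with hr | ⟨_, hr⟩
      · exact hp hr
      · have := congrArg (Polynomial.coeff · 1) hr
        simp [hω0] at this
    have hdr : r.natDegree = 0 := by
      have := congrArg Polynomial.natDegree hr
      rw [hcompdeg, Polynomial.natDegree_mul hp hr0] at this
      omega
    rw [Polynomial.natDegree_eq_zero] at hdr
    obtain ⟨μ, hμ⟩ := hdr
    exact ⟨μ, by rw [hr, ← hμ, mul_comm]⟩
  obtain ⟨lam, hlam⟩ := hscale f g hcop hfg
  have hlam' : f ≠ 0 → g.comp (Polynomial.C ω * Polynomial.X) = Polynomial.C lam * g := by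
    intro hf0
    apply mul_left_cancel₀ hf0
    rw [← hfg, hlam]; ring
  have hf0 : f ≠ 0 := by
    rintro h0
    rw [h0, isCoprime_zero_left] at hcop
    rw [h0, Polynomial.natDegree_eq_zero_of_isUnit hcop] at hdeg
    simp at hdeg
  replace hlam' := hlam' hf0
  have hcf : ∀ n, f.coeff n * ω ^ n = lam * f.coeff n := by
    intro n
    rw [← Polynomial.comp_C_mul_X_coeff, hlam, Polynomial.coeff_C_mul]
  have hcg : ∀ n, g.coeff n * ω ^ n = lam * g.coeff n := by
    intro n
    rw [← Polynomial.comp_C_mul_X_coeff, hlam', Polynomial.coeff_C_mul]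
  have hlead : f.coeff 3 ≠ 0 ∨ g.coeff 3 ≠ 0 := by
    rcases max_choice f.natDegree g.natDegree with h | h
    · left; rw [← hdeg, h]; simpa using hf0
    · right; rw [← hdeg, h]; simpa using hg0
  -- numerator and denominator are eigenvectors for the same eigenvalue, which is `1` because one of
  -- them has degree three
  have hlam1 : lam = 1 := by
    rcases hlead with h | h
    · have := hcf 3
      rw [hω3, mul_one] at this
      exact mul_right_cancel₀ h (by rw [← this, one_mul])
    · have := hcg 3
      rw [hω3, mul_one] at this
      exact mul_right_cancel₀ h (by rw [← this, one_mul])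
  have hshape : ∀ p : Polynomial K, p.natDegree ≤ 3 →
      (∀ n, p.coeff n * ω ^ n = lam * p.coeff n) →
      p = Polynomial.C (p.coeff 3) * Polynomial.X ^ 3 + Polynomial.C (p.coeff 0) := by
    intro p hp hc
    have h1 : p.coeff 1 = 0 := by
      have := hc 1
      rw [hlam1, pow_one] at this
      have h' : p.coeff 1 * (ω - 1) = 0 := by linear_combination this
      exact (mul_eq_zero.1 h').resolve_right (sub_ne_zero.2 hω)
    have h2 : p.coeff 2 = 0 := by
      have := hc 2
      rw [hlam1] at this
      have h' : p.coeff 2 * (ω ^ 2 - 1) = 0 := by linear_combination this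
      exact (mul_eq_zero.1 h').resolve_right (sub_ne_zero.2 hω2)
    conv_lhs => rw [p.as_sum_range_C_mul_X_pow' (n := 4) (by omega)]
    simp [Finset.sum_range_succ, h1, h2]
    ring
  have hf' := hshape f (le_of_max_le_left hdeg.le) hcf
  have hg' := hshape g (le_of_max_le_right hdeg.le) hcg
  refine ⟨f.coeff 3, f.coeff 0, g.coeff 3, g.coeff 0, ?_, ?_⟩
  · intro hdet
    have hprop : Polynomial.C (g.coeff 3) * f = Polynomial.C (f.coeff 3) * g := by
      have hd : Polynomial.C (f.coeff 3) * Polynomial.C (g.coeff 0) =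
          Polynomial.C (f.coeff 0) * Polynomial.C (g.coeff 3) := by
        rw [← map_mul, ← map_mul, sub_eq_zero.1 hdet]
      rw [hf', hg']
      simp
      linear_combination -hd
    obtain ⟨r, s, hrs⟩ := hcop
    have hgu : Polynomial.C (g.coeff 3) =
        g * (r * Polynomial.C (f.coeff 3) + s * Polynomial.C (g.coeff 3)) := by
      linear_combination (-Polynomial.C (g.coeff 3)) * hrs + r * hprop
    have hfu : Polynomial.C (f.coeff 3) =
        f * (r * Polynomial.C (f.coeff 3) + s * Polynomial.C (g.coeff 3)) := by
      linear_combination (-Polynomial.C (f.coeff 3)) * hrs - s * hprop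
    have hkey : ∀ q t : Polynomial K, q.coeff 3 ≠ 0 → Polynomial.C (q.coeff 3) = q * t → False := by
      intro q t hq h
      have hu : IsUnit q := isUnit_of_dvd_unit (Dvd.intro _ h.symm)
        (Polynomial.isUnit_C.2 hq.isUnit)
      have := Polynomial.le_natDegree_of_ne_zero hq
      rw [Polynomial.natDegree_eq_zero_of_isUnit hu] at this
      omega
    rcases hlead with h | h
    · exact hkey f _ h hfu
    · exact hkey g _ h hgu
  · rw [hf', hg'] at hufg
    simpa using hufg

/-- A cyclic cubic subextension `K(u)` of `K(X)` is, after a change of the parameter `X`,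
generated by `X ^ 3`: an automorphism of order three of the projective line has two fixed points
and is diagonal when these are moved to `0` and `∞`. -/
theorem exists_algEquiv_eq_cube_moebius [IsAlgClosed K] (h3 : (3 : K) ≠ 0) (u : RatFunc K)
    [IsGalois K⟮u⟯ (RatFunc K)] (hu : Module.finrank K⟮u⟯ (RatFunc K) = 3) :
    ∃ θ : RatFunc K ≃ₐ[K] RatFunc K, ∃ α β γ δ : K, α * δ - β * γ ≠ 0 ∧
      θ u * (C γ * X ^ 3 + C δ) = C α * X ^ 3 + C β := by
  have : FiniteDimensional K⟮u⟯ (RatFunc K) := Module.finite_of_finrank_pos (by omega)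
  have hcard := IsGalois.card_aut_eq_finrank K⟮u⟯ (RatFunc K)
  rw [hu] at hcard
  have : Nontrivial Gal(RatFunc K/K⟮u⟯) := by
    have : Finite Gal(RatFunc K/K⟮u⟯) := Nat.finite_of_card_ne_zero (by omega)
    exact Finite.one_lt_card_iff_nontrivial.1 (by omega)
  obtain ⟨σ, hσ⟩ := exists_ne (1 : Gal(RatFunc K/K⟮u⟯))
  have hσ3 : σ ^ 3 = 1 := by rw [← hcard]; exact pow_card_eq_one'
  obtain ⟨s, hs, ω, hω3, hω, hωs⟩ := exists_scaling_of_algEquiv h3 (σ.restrictScalars K)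
    (fun h => hσ (by ext z; exact congrArg (fun f : RatFunc K ≃ₐ[K] RatFunc K => f z) h))
    (by
      ext z
      have := congrArg (fun f : Gal(RatFunc K/K⟮u⟯) => f z) hσ3
      simpa [pow_succ] using this)
  obtain ⟨θ, hθ⟩ := exists_algEquiv_X_eq hs
  refine ⟨θ.symm, eq_cube_moebius (σ := (θ.trans (σ.restrictScalars K)).trans θ.symm)
    hω3 hω ?_ ?_ ?_⟩
  · simp only [AlgEquiv.trans_apply, hθ, hωs, map_mul, algEquiv_C]
    rw [← hθ, AlgEquiv.symm_apply_apply]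
  · simp only [AlgEquiv.trans_apply, AlgEquiv.apply_symm_apply]
    congr 1
    exact σ.commutes ⟨u, mem_adjoin_simple_self K u⟩
  · rw [← finrank_eq_max_natDegree, finrank_adjoin_algEquiv, hu]

/-! ### Pole orders in the cubic equation at a total flex -/

/-- The degree `intDegree r` is at most `n`, where `0` has degree `-∞`. -/
def DegLE (r : RatFunc K) (n : ℤ) : Prop := r = 0 ∨ r.intDegree ≤ n

theorem DegLE.add {r s : RatFunc K} {n : ℤ} (hr : r.DegLE n) (hs : s.DegLE n) :
    (r + s).DegLE n := by
  rcases hr with rfl | hr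
  · rwa [zero_add]
  rcases eq_or_ne s 0 with rfl | h0
  · rw [add_zero]; exact Or.inr hr
  have hs := hs.resolve_left h0
  by_cases h : r + s = 0
  · exact Or.inl h
  · exact Or.inr ((intDegree_add_le h0 h).trans (max_le hr hs))

theorem DegLE.mul {r s : RatFunc K} {m n : ℤ} (hr : r.DegLE m) (hs : s.DegLE n) :
    (r * s).DegLE (m + n) := by
  rcases eq_or_ne r 0 with rfl | hr0
  · exact Or.inl (zero_mul _)
  rcases eq_or_ne s 0 with rfl | hs0
  · exact Or.inl (mul_zero _)
  right
  rw [intDegree_mul hr0 hs0]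
  exact add_le_add (hr.resolve_left hr0) (hs.resolve_left hs0)

theorem DegLE.pow {r : RatFunc K} {m : ℤ} (hr : r.DegLE m) (n : ℕ) :
    (r ^ n).DegLE (n * m) := by
  induction n with
  | zero => right; simp
  | succ n ih =>
    rw [pow_succ]
    have := ih.mul hr
    push_cast
    rwa [add_mul, one_mul]

theorem DegLE.mono {r : RatFunc K} {m n : ℤ} (hr : r.DegLE m) (h : m ≤ n) : r.DegLE n :=
  hr.imp id fun h' => h'.trans h

theorem degLE_C (a : K) : (C a).DegLE 0 := Or.inr (intDegree_C a).le

theorem degLE_intDegree (r : RatFunc K) : r.DegLE r.intDegree := Or.inr le_rfl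

/-- If `v` is a root of a cubic over `K[u]` whose coefficients have degrees `0, ≤ 1, ≤ 2, 4` in
`u`, and `u` has a pole at infinity, then the leading and the constant term have the same pole
order. -/
theorem three_mul_intDegree_eq {u v : RatFunc K} {c a₂ b₂ a₁ b₁ d₁ f₀ f₁ f₂ f₃ f₄ : K}
    (hc : c ≠ 0) (hf : f₄ ≠ 0) (hu : 0 < u.intDegree)
    (h : C c * v ^ 3 + (C a₂ + C b₂ * u) * v ^ 2 + (C a₁ + C b₁ * u + C d₁ * u ^ 2) * v +
      (C f₀ + C f₁ * u + C f₂ * u ^ 2 + C f₃ * u ^ 3 + C f₄ * u ^ 4) = 0) :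
    3 * v.intDegree = 4 * u.intDegree := by
  obtain ⟨d, hd⟩ : ∃ d, d = u.intDegree := ⟨_, rfl⟩
  obtain ⟨e, he⟩ : ∃ e, e = v.intDegree := ⟨_, rfl⟩
  rw [← hd] at hu ⊢
  rw [← he]
  have hu0 : u ≠ 0 := by rintro rfl; simp [hd] at hu
  have hU : u.DegLE d := hd ▸ degLE_intDegree u
  have hV : v.DegLE e := he ▸ degLE_intDegree v
  have term : ∀ (a : K) (i j : ℕ) {n : ℤ}, i * d + j * e ≤ n →
      (C a * (u ^ i * v ^ j)).DegLE n := fun a i j n hn =>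
    ((degLE_C a).mul ((hU.pow i).mul (hV.pow j))).mono (by simpa using hn)
  have hlead : ∀ (a : K) (r : RatFunc K) (k n : ℤ) (m : ℕ), a ≠ 0 → r ≠ 0 → r.intDegree = k →
      (C a * r ^ m).DegLE n → m * k ≤ n := by
    intro a r k n m ha hr hk hle
    have ha' : C a ≠ 0 := (map_ne_zero C).2 ha
    have h2 := hle.resolve_left (mul_ne_zero ha' (pow_ne_zero m hr))
    have hp : ∀ m : ℕ, (r ^ m).intDegree = m * k := by
      intro m
      induction m with
      | zero => simp
      | succ m ih =>
        rw [pow_succ, intDegree_mul (pow_ne_zero m hr) hr, ih, hk]; push_cast; ring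
    rwa [intDegree_mul ha' (pow_ne_zero m hr), intDegree_C, zero_add, hp] at h2
  have hrest : ∀ n : ℤ, 2 * e ≤ n → d + 2 * e ≤ n → e ≤ n → d + e ≤ n → 2 * d + e ≤ n →
      3 * d ≤ n → (C a₂ * (u ^ 0 * v ^ 2) + C b₂ * (u ^ 1 * v ^ 2) + C a₁ * (u ^ 0 * v ^ 1) +
        C b₁ * (u ^ 1 * v ^ 1) + C d₁ * (u ^ 2 * v ^ 1) + C f₀ * (u ^ 0 * v ^ 0) +
        C f₁ * (u ^ 1 * v ^ 0) + C f₂ * (u ^ 2 * v ^ 0) + C f₃ * (u ^ 3 * v ^ 0)).DegLE n := by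
    intro n h1 h2 h3 h4 h5 h6
    refine ((((((((term _ _ _ ?_).add (term _ _ _ ?_)).add (term _ _ _ ?_)).add
      (term _ _ _ ?_)).add (term _ _ _ ?_)).add (term _ _ _ ?_)).add (term _ _ _ ?_)).add
      (term _ _ _ ?_)).add (term _ _ _ ?_) <;> push_cast <;> linarith
  rcases lt_trichotomy (3 * e) (4 * d) with hlt | heq | hgt
  · exfalso
    have h1 := (hrest (4 * d - 1) (by omega) (by omega) (by omega) (by omega) (by omega)
      (by omega)).add (term c 0 3 (n := 4 * d - 1) (by push_cast; omega))
    have h2 := hlead (-f₄) u d (4 * d - 1) 4 (neg_ne_zero.2 hf) hu0 hd.symm (by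
      convert h1 using 1
      rw [map_neg]
      linear_combination -h)
    push_cast at h2
    omega
  · exact heq
  · exfalso
    have hv0 : v ≠ 0 := by rintro rfl; simp at he; omega
    have h1 := (hrest (3 * e - 1) (by omega) (by omega) (by omega) (by omega) (by omega)
      (by omega)).add (term f₄ 4 0 (n := 3 * e - 1) (by push_cast; omega))
    have h2 := hlead (-c) v e (3 * e - 1) 3 (neg_ne_zero.2 hc) hv0 he.symm (by
      convert h1 using 1
      rw [map_neg]
      linear_combination -h)
    push_cast at h2
    omega

theorem adjoin_inv_add_C (τ : K) : K⟮(X : RatFunc K)⁻¹ + C τ⟯ = ⊤ := by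
  obtain ⟨s, hs⟩ : ∃ s, s = (X : RatFunc K)⁻¹ + C τ := ⟨_, rfl⟩
  have hXs : (X : RatFunc K) = (s - C τ)⁻¹ := by rw [hs]; simp
  rw [← hs, eq_top_iff, ← adjoin_X, adjoin_simple_le_iff, hXs]
  exact inv_mem (sub_mem (mem_adjoin_simple_self K s) (IntermediateField.algebraMap_mem K⟮s⟯ τ))

/-- Let `v` satisfy a cubic equation over `K(u)` of the shape of a quartic curve at a point where
the tangent line meets the curve four times. If `u` is a Möbius transform of `X ^ 3`, then the
pole of `u` is totally ramified, so that after a change of parameter `u` is an affine function of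
`X ^ 3` and `v` is a polynomial of degree four. -/
theorem exists_parameter_of_cubic [IsAlgClosed K] (h3 : (3 : K) ≠ 0)
    {u v : RatFunc K} {c a₂ b₂ a₁ b₁ d₁ f₀ f₁ f₂ f₃ f₄ : K}
    (hc : c ≠ 0) (hf : f₄ ≠ 0)
    (h : C c * v ^ 3 + (C a₂ + C b₂ * u) * v ^ 2 + (C a₁ + C b₁ * u + C d₁ * u ^ 2) * v +
      (C f₀ + C f₁ * u + C f₂ * u ^ 2 + C f₃ * u ^ 3 + C f₄ * u ^ 4) = 0)
    {α β γ δ : K} (hdet : α * δ - β * γ ≠ 0)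
    (hu : u * (C γ * X ^ 3 + C δ) = C α * X ^ 3 + C β) :
    ∃ θ : RatFunc K ≃ₐ[K] RatFunc K, ∃ (a b : K) (q : Polynomial K), a ≠ 0 ∧ q.natDegree = 4 ∧
      θ u = C a * X ^ 3 + C b ∧ θ v = algebraMap _ _ q := by
  have hXdeg : ∀ a b : K, a ≠ 0 → (C a * X ^ 3 + C b).intDegree = 3 := by
    intro a b ha
    have : C a * X ^ 3 + C b = algebraMap _ (RatFunc K)
        (Polynomial.C a * Polynomial.X ^ 3 + Polynomial.C b) := by simp
    rw [this, intDegree_polynomial]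
    have : (Polynomial.C a * Polynomial.X ^ 3 + Polynomial.C b).natDegree = 3 := by
      compute_degree!
    rw [this]; rfl
  have heq : ∀ θ : RatFunc K ≃ₐ[K] RatFunc K,
      C c * (θ v) ^ 3 + (C a₂ + C b₂ * θ u) * (θ v) ^ 2 +
        (C a₁ + C b₁ * θ u + C d₁ * (θ u) ^ 2) * θ v +
      (C f₀ + C f₁ * θ u + C f₂ * (θ u) ^ 2 + C f₃ * (θ u) ^ 3 + C f₄ * (θ u) ^ 4) = 0 := by
    intro θ
    have := congrArg θ h
    simpa only [map_add, map_mul, map_pow, algEquiv_C, map_zero] using this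
  suffices hθ : ∃ θ : RatFunc K ≃ₐ[K] RatFunc K, ∃ a b : K, a ≠ 0 ∧ θ u = C a * X ^ 3 + C b by
    obtain ⟨θ, a, b, ha, hab⟩ := hθ
    have h' := heq θ
    have hdegu : (θ u).intDegree = 3 := by rw [hab, hXdeg a b ha]
    have hdegv := three_mul_intDegree_eq hc hf (by rw [hdegu]; norm_num) h'
    rw [hdegu] at hdegv
    have hint : IsIntegral (Polynomial K) (θ v) := by
      obtain ⟨w, hw⟩ : ∃ w : Polynomial K, w = Polynomial.C a * Polynomial.X ^ 3 +
        Polynomial.C b := ⟨_, rfl⟩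
      have hwu : algebraMap _ _ w = θ u := by rw [hw, hab]; simp
      have hcc : C c⁻¹ * C c = 1 := by rw [← map_mul, inv_mul_cancel₀ hc, map_one]
      obtain ⟨e₂, he₂⟩ : ∃ e : Polynomial K, e = Polynomial.C c⁻¹ *
        (Polynomial.C a₂ + Polynomial.C b₂ * w) := ⟨_, rfl⟩
      obtain ⟨e₁, he₁⟩ : ∃ e : Polynomial K, e = Polynomial.C c⁻¹ *
        (Polynomial.C a₁ + Polynomial.C b₁ * w + Polynomial.C d₁ * w ^ 2) := ⟨_, rfl⟩
      obtain ⟨e₀, he₀⟩ : ∃ e : Polynomial K, e = Polynomial.C c⁻¹ *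
        (Polynomial.C f₀ + Polynomial.C f₁ * w + Polynomial.C f₂ * w ^ 2 +
          Polynomial.C f₃ * w ^ 3 + Polynomial.C f₄ * w ^ 4) := ⟨_, rfl⟩
      refine ⟨Polynomial.X ^ 3 + (Polynomial.C e₂ * Polynomial.X ^ 2 +
        Polynomial.C e₁ * Polynomial.X + Polynomial.C e₀), ?_, ?_⟩
      · apply Polynomial.monic_X_pow_add
        exact lt_of_le_of_lt Polynomial.degree_quadratic_le (by norm_num)
      · simp only [Polynomial.eval₂_add, Polynomial.eval₂_mul, Polynomial.eval₂_pow,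
          Polynomial.eval₂_X, Polynomial.eval₂_C, he₂, he₁, he₀, map_add, map_mul, map_pow, hwu,
          algebraMap_C]
        linear_combination C c⁻¹ * h' - (θ v) ^ 3 * hcc
    obtain ⟨q, hq⟩ := IsIntegrallyClosed.isIntegral_iff.1 hint
    refine ⟨θ, a, b, q, ha, ?_, hab, hq.symm⟩
    rw [← hq, intDegree_polynomial] at hdegv
    omega
  have hX0 : (X : RatFunc K) ≠ 0 := X_ne_zero
  have hC0 : ∀ a : K, a ≠ 0 → (C a : RatFunc K) ≠ 0 := fun a => (map_ne_zero C).2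
  by_cases hγ : γ = 0
  · have hδ : δ ≠ 0 := by rintro rfl; simp [hγ] at hdet
    have hα : α ≠ 0 := by rintro rfl; simp [hγ] at hdet
    refine ⟨AlgEquiv.refl, α / δ, β / δ, div_ne_zero hα hδ, ?_⟩
    have hδ' := hC0 δ hδ
    rw [hγ, map_zero, zero_mul, zero_add] at hu
    simp only [AlgEquiv.coe_refl, id, map_div₀]
    field_simp
    exact hu
  obtain ⟨τ, hτ⟩ := IsAlgClosed.exists_pow_nat_eq (-δ / γ) (n := 3) (by norm_num)
  have hτ' : γ * τ ^ 3 + δ = 0 := by rw [hτ]; field_simp; ring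
  -- move the pole `τ` of `u` to `∞`
  obtain ⟨θ, hθ⟩ := exists_algEquiv_X_eq (adjoin_inv_add_C τ)
  have hu' := congrArg θ hu
  simp only [map_add, map_mul, map_pow, algEquiv_C, hθ] at hu'
  have hατ : α * τ ^ 3 + β ≠ 0 := by
    intro h0
    apply hdet
    linear_combination α * hτ' - γ * h0
  have hτC : C γ * C τ ^ 3 + C δ = 0 := by
    rw [← map_pow, ← map_mul, ← map_add, hτ', map_zero]
  by_cases hδ : δ = 0
  · have hτ0 : τ = 0 := by
      have : γ * τ ^ 3 = 0 := by simpa [hδ] using hτ'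
      exact pow_eq_zero_iff (by norm_num) |>.1 ((mul_eq_zero.1 this).resolve_left hγ)
    have hβ : β ≠ 0 := by rintro rfl; simp [hτ0] at hατ
    refine ⟨θ, β / γ, α / γ, div_ne_zero hβ hγ, ?_⟩
    have hγ' := hC0 γ hγ
    rw [hδ, hτ0, map_zero, add_zero, add_zero] at hu'
    rw [map_div₀, map_div₀]
    field_simp at hu' ⊢
    linear_combination hu'
  -- otherwise `u` has a simple pole at `τ`, and the pole orders of the cubic do not match
  · exfalso
    have hτ0 : τ ≠ 0 := by rintro rfl; simp [hδ] at hτ'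
    have hden : (Polynomial.C (3 * γ * τ ^ 2) * Polynomial.X ^ 2 +
        Polynomial.C (3 * γ * τ) * Polynomial.X + Polynomial.C γ).natDegree = 2 :=
      Polynomial.natDegree_quadratic (mul_ne_zero (mul_ne_zero h3 hγ) (pow_ne_zero 2 hτ0))
    have hnum : (Polynomial.C (α * τ ^ 3 + β) * Polynomial.X ^ 3 +
        Polynomial.C (3 * α * τ ^ 2) * Polynomial.X ^ 2 +
        Polynomial.C (3 * α * τ) * Polynomial.X + Polynomial.C α).natDegree = 3 :=
      Polynomial.natDegree_cubic hατ
    have hprod : θ u * algebraMap _ _ (Polynomial.C (3 * γ * τ ^ 2) * Polynomial.X ^ 2 +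
        Polynomial.C (3 * γ * τ) * Polynomial.X + Polynomial.C γ) =
        algebraMap _ _ (Polynomial.C (α * τ ^ 3 + β) * Polynomial.X ^ 3 +
        Polynomial.C (3 * α * τ ^ 2) * Polynomial.X ^ 2 +
        Polynomial.C (3 * α * τ) * Polynomial.X + Polynomial.C α) := by
      simp only [map_add, map_mul, map_pow, algebraMap_C, algebraMap_X, map_ofNat]
      field_simp at hu'
      linear_combination hu' - θ u * X ^ 3 * hτC
    have hnum0 := algebraMap_ne_zero (K := K) (fun h0 => by
      rw [h0] at hnum; simp at hnum : (Polynomial.C (α * τ ^ 3 + β) * Polynomial.X ^ 3 +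
        Polynomial.C (3 * α * τ ^ 2) * Polynomial.X ^ 2 +
        Polynomial.C (3 * α * τ) * Polynomial.X + Polynomial.C α) ≠ 0)
    rw [← hprod] at hnum0
    have hdeg := congrArg intDegree hprod
    rw [intDegree_mul (left_ne_zero_of_mul hnum0) (right_ne_zero_of_mul hnum0),
      intDegree_polynomial, intDegree_polynomial, hden, hnum] at hdeg
    have := three_mul_intDegree_eq hc hf (by push_cast at hdeg; omega) (heq θ)
    push_cast at hdeg
    omega

end RatFunc

end

noncomputable section

open IntermediateField MvPolynomial
open scoped Matrix

namespace PlaneCurve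

variable {K : Type*} [Field K] {E : Type*} [Field E] [Algebra K E]

/-! ### Generic points and linear changes of coordinates -/

theorem _root_.MvPolynomial.IsHomogeneous.aeval_mul_left {σ R S : Type*} [Fintype σ]
    [CommSemiring R] [CommSemiring S] [Algebra R S] {Q : MvPolynomial σ R} {k : ℕ}
    (hQ : Q.IsHomogeneous k) (s : S) (f : σ → S) :
    aeval (fun i => s * f i) Q = s ^ k * aeval f Q := by
  simp only [aeval_def, eval₂_eq, Finset.mul_sum]
  refine Finset.sum_congr rfl fun m hm => ?_
  have hdeg : ∑ i, m i = k := by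
    have := hQ (mem_support_iff.1 hm)
    rw [← this, Finsupp.weight_apply, Finsupp.sum_fintype _ _ (by simp)]
    simp
  have hsupp : ∏ i ∈ m.support, s ^ m i = s ^ k := by
    rw [Finset.prod_pow_eq_pow_sum, ← hdeg]
    congr 1
    exact Finset.sum_subset (Finset.subset_univ _) (by simp)
  simp only [mul_pow, Finset.prod_mul_distrib, hsupp]
  ring

/-- `x` is a vector of homogeneous coordinates of a generic point of the plane curve `F = 0`: the
forms vanishing at `x` are the multiples of `F`, and the field `E` consists of the values at `x` of
quotients of forms of the same degree, so that `E` is a copy of the function field. -/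
structure IsGenericPoint (F : MvPolynomial (Fin 3) K) (x : Fin 3 → E) : Prop where
  aeval_eq_zero : aeval x F = 0
  dvd_of_aeval_eq_zero : ∀ (k : ℕ) (Q : MvPolynomial (Fin 3) K), Q.IsHomogeneous k →
    aeval x Q = 0 → F ∣ Q
  exists_eq_div : ∀ z : E, ∃ (k : ℕ) (Q R : MvPolynomial (Fin 3) K), Q.IsHomogeneous k ∧
    R.IsHomogeneous k ∧ aeval x R ≠ 0 ∧ z = aeval x Q / aeval x R

/-- The subfield generated by the quotients of linear forms vanishing at `P`, evaluated at a
generic point `x`: the function field of the target of the projection from `P`. -/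
def projField (x : Fin 3 → E) (P : Fin 3 → K) : IntermediateField K E :=
  IntermediateField.adjoin K {z | ∃ l m : MvPolynomial (Fin 3) K,
    l.IsHomogeneous 1 ∧ m.IsHomogeneous 1 ∧ eval P l = 0 ∧ eval P m = 0 ∧ aeval x m ≠ 0 ∧
    z = aeval x l / aeval x m}

section Transport

variable {E' : Type*} [Field E'] [Algebra K E']

theorem aeval_algEquiv (e : E ≃ₐ[K] E') (x : Fin 3 → E) (Q : MvPolynomial (Fin 3) K) :
    aeval (fun i => e (x i)) Q = e (aeval x Q) := by
  have := comp_aeval_apply (R := K) x (e : E →ₐ[K] E') Q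
  exact this.symm

theorem IsGenericPoint.map {F : MvPolynomial (Fin 3) K} {x : Fin 3 → E} (hx : IsGenericPoint F x)
    (e : E ≃ₐ[K] E') : IsGenericPoint F (fun i => e (x i)) where
  aeval_eq_zero := by rw [aeval_algEquiv, hx.aeval_eq_zero, map_zero]
  dvd_of_aeval_eq_zero k Q hQ h := by
    rw [aeval_algEquiv] at h
    exact hx.dvd_of_aeval_eq_zero k Q hQ (e.injective (h.trans (map_zero e).symm))
  exists_eq_div z := by
    obtain ⟨k, Q, R, hQ, hR, h0, hz⟩ := hx.exists_eq_div (e.symm z)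
    refine ⟨k, Q, R, hQ, hR, ?_, ?_⟩
    · rw [aeval_algEquiv]; exact fun h => h0 (e.injective (h.trans (map_zero e).symm))
    · rw [aeval_algEquiv, aeval_algEquiv, ← map_div₀, ← hz, AlgEquiv.apply_symm_apply]

theorem isGalois_map (e : E ≃ₐ[K] E') (L : IntermediateField K E) [IsGalois L E] :
    IsGalois (L.map (e : E →ₐ[K] E')) E' :=
  IsGalois.of_equiv_equiv (F := L) (E := E)
    (f := (IntermediateField.intermediateFieldMap e L).toRingEquiv) (g := e.toRingEquiv)
    (by ext; rfl)

theorem isGalois_projField_map (e : E ≃ₐ[K] E') (x : Fin 3 → E) (P : Fin 3 → K)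
    [IsGalois (projField x P) E] : IsGalois (projField (fun i => e (x i)) P) E' := by
  have : projField (fun i => e (x i)) P = (projField x P).map (e : E →ₐ[K] E') := by
    rw [projField, projField, IntermediateField.adjoin_map]
    congr 1
    ext z
    simp only [Set.mem_ofPred_eq, Set.mem_image, aeval_algEquiv]
    constructor
    · rintro ⟨l, m, hl, hm, hlP, hmP, h0, rfl⟩
      refine ⟨_, ⟨l, m, hl, hm, hlP, hmP, ?_, rfl⟩, map_div₀ _ _ _⟩
      rintro h; exact h0 (by rw [h, map_zero])
    · rintro ⟨_, ⟨l, m, hl, hm, hlP, hmP, h0, rfl⟩, rfl⟩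
      refine ⟨l, m, hl, hm, hlP, hmP, ?_, map_div₀ _ _ _⟩
      exact fun h => h0 (e.injective (h.trans (map_zero e).symm))
  rw [this]
  exact isGalois_map e _

end Transport

theorem IsGenericPoint.mul_left {F : MvPolynomial (Fin 3) K} {d : ℕ} (hF : F.IsHomogeneous d)
    {x : Fin 3 → E} (hx : IsGenericPoint F x) {s : E} (hs : s ≠ 0) :
    IsGenericPoint F (fun i => s * x i) where
  aeval_eq_zero := by rw [hF.aeval_mul_left, hx.aeval_eq_zero, mul_zero]
  dvd_of_aeval_eq_zero k Q hQ h := by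
    rw [hQ.aeval_mul_left] at h
    exact hx.dvd_of_aeval_eq_zero k Q hQ ((mul_eq_zero.1 h).resolve_left (pow_ne_zero k hs))
  exists_eq_div z := by
    obtain ⟨k, Q, R, hQ, hR, h0, hz⟩ := hx.exists_eq_div z
    refine ⟨k, Q, R, hQ, hR, ?_, ?_⟩
    · rw [hR.aeval_mul_left]; exact mul_ne_zero (pow_ne_zero k hs) h0
    · rw [hQ.aeval_mul_left, hR.aeval_mul_left, mul_div_mul_left _ _ (pow_ne_zero k hs), hz]

theorem projField_mul_left (x : Fin 3 → E) (P : Fin 3 → K) {s : E} (hs : s ≠ 0) :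
    projField (fun i => s * x i) P = projField x P := by
  rw [projField, projField]
  congr 1
  ext z
  refine exists_congr fun l => exists_congr fun m => and_congr_right fun hl =>
    and_congr_right fun hm => ?_
  rw [hl.aeval_mul_left, hm.aeval_mul_left, mul_div_mul_left _ _ (pow_ne_zero 1 hs),
    mul_ne_zero_iff]
  simp [hs]

/-- The linear substitution `Q ↦ Q ∘ A`. -/
def linSubst (A : Matrix (Fin 3) (Fin 3) K) :
    MvPolynomial (Fin 3) K →ₐ[K] MvPolynomial (Fin 3) K :=
  aeval fun i => ∑ j, C (A i j) * X j

theorem aeval_linSubst {R : Type*} [CommRing R] [Algebra K R] (A : Matrix (Fin 3) (Fin 3) K)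
    (x : Fin 3 → R) (Q : MvPolynomial (Fin 3) K) :
    aeval x (linSubst A Q) = aeval (A.map (algebraMap K R) *ᵥ x) Q := by
  rw [linSubst, comp_aeval_apply]
  congr 2
  funext i
  simp [Matrix.mulVec, dotProduct]

theorem linSubst_isHomogeneous (A : Matrix (Fin 3) (Fin 3) K) {Q : MvPolynomial (Fin 3) K} {k : ℕ}
    (hQ : Q.IsHomogeneous k) : (linSubst A Q).IsHomogeneous k := by
  have := hQ.aeval (S := K) (n := 1) (fun i => ∑ j, C (A i j) * X j) fun i =>
    IsHomogeneous.sum _ _ _ fun j _ => (isHomogeneous_C_mul_X (A i j) j)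
  rwa [one_mul] at this

theorem map_mul_mulVec {R : Type*} [CommRing R] [Algebra K R] {A B : Matrix (Fin 3) (Fin 3) K}
    (h : A * B = 1) (x : Fin 3 → R) :
    A.map (algebraMap K R) *ᵥ (B.map (algebraMap K R) *ᵥ x) = x := by
  rw [Matrix.mulVec_mulVec, ← Matrix.map_mul, h,
    Matrix.map_one _ (map_zero _) (map_one _), Matrix.one_mulVec]

theorem linSubst_linSubst {A B : Matrix (Fin 3) (Fin 3) K} (h : A * B = 1)
    (Q : MvPolynomial (Fin 3) K) : linSubst B (linSubst A Q) = Q := by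
  have hB : ∀ Q : MvPolynomial (Fin 3) K,
      linSubst B Q = aeval (B.map (algebraMap K (MvPolynomial (Fin 3) K)) *ᵥ X) Q := by
    intro Q
    rw [← aeval_linSubst, aeval_X_left_apply]
  rw [hB, aeval_linSubst, map_mul_mulVec h, aeval_X_left_apply]

theorem IsGenericPoint.linSubst {F : MvPolynomial (Fin 3) K} {x : Fin 3 → E}
    (hx : IsGenericPoint F x) {A B : Matrix (Fin 3) (Fin 3) K} (hAB : A * B = 1)
    (hBA : B * A = 1) :
    IsGenericPoint (linSubst A F) (B.map (algebraMap K E) *ᵥ x) where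
  aeval_eq_zero := by rw [aeval_linSubst, map_mul_mulVec hAB, hx.aeval_eq_zero]
  dvd_of_aeval_eq_zero k Q hQ h := by
    rw [← aeval_linSubst] at h
    have := map_dvd (PlaneCurve.linSubst A)
      (hx.dvd_of_aeval_eq_zero k _ (linSubst_isHomogeneous B hQ) h)
    rwa [linSubst_linSubst hBA] at this
  exists_eq_div z := by
    obtain ⟨k, Q, R, hQ, hR, h0, hz⟩ := hx.exists_eq_div z
    refine ⟨k, _, _, linSubst_isHomogeneous A hQ, linSubst_isHomogeneous A hR, ?_, ?_⟩
    · rwa [aeval_linSubst, map_mul_mulVec hAB]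
    · rwa [aeval_linSubst, aeval_linSubst, map_mul_mulVec hAB]

theorem exists_eq_linear {l : MvPolynomial (Fin 3) K} (hl : l.IsHomogeneous 1) :
    ∃ a : Fin 3 → K, l = ∑ i, C (a i) * X i := by
  refine ⟨fun i => (pderiv i l).coeff 0, ?_⟩
  have h := hl.sum_X_mul_pderiv
  rw [one_smul] at h
  rw [← h]
  refine Finset.sum_congr rfl fun i _ => ?_
  rw [h, mul_comm]
  congr 1
  have h0 : (pderiv i l).totalDegree = 0 := by
    have := (hl.pderiv (i := i)).totalDegree_le
    omega
  rw [totalDegree_eq_zero_iff_eq_C] at h0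
  exact h0

/-- In coordinates `y` for which `P` is the point `(1 : 0 : 0)`, the projection from `P` is
`(y 1 : y 2)`. -/
theorem projField_eq_adjoin {x : Fin 3 → E} {P : Fin 3 → K} {A B : Matrix (Fin 3) (Fin 3) K}
    (hAB : A * B = 1) (hBA : B * A = 1) (hP : ∀ i, A i 0 = P i) {y : Fin 3 → E}
    (hy : y = B.map (algebraMap K E) *ᵥ x) (hy2 : y 2 ≠ 0) :
    projField x P = K⟮y 1 / y 2⟯ := by
  apply le_antisymm
  · rw [projField, IntermediateField.adjoin_le_iff]
    rintro _ ⟨l, m, hl, hm, hlP, hmP, h0, rfl⟩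
    have key : ∀ l : MvPolynomial (Fin 3) K, l.IsHomogeneous 1 → eval P l = 0 →
        aeval x l / y 2 ∈ K⟮y 1 / y 2⟯ := by
      intro l hl hlP
      obtain ⟨a, ha⟩ := exists_eq_linear (linSubst_isHomogeneous A hl)
      have ha0 : a 0 = 0 := by
        have h1 := aeval_linSubst (R := K) A (Pi.single 0 1) l
        have h2 : A.map (algebraMap K K) *ᵥ Pi.single 0 1 = P := by
          funext i
          simp [hP]
        rw [h2, ha] at h1
        simp only [Fin.sum_univ_three, map_add, map_mul, aeval_C, aeval_X] at h1
        rw [show aeval P l = eval P l from congrFun (congrArg DFunLike.coe (coe_aeval_eq_eval P)) l,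
          hlP] at h1
        simpa using h1
      have h1 := aeval_linSubst (R := E) A y l
      rw [hy, map_mul_mulVec hAB, ← hy, ha] at h1
      rw [← h1]
      simp only [Fin.sum_univ_three, map_add, map_mul, aeval_C, aeval_X, ha0, map_zero, zero_mul,
        zero_add]
      rw [add_div, mul_div_assoc, mul_div_assoc, div_self hy2, mul_one]
      exact add_mem (mul_mem (IntermediateField.algebraMap_mem _ _) (mem_adjoin_simple_self K _))
        (IntermediateField.algebraMap_mem _ _)
    rw [← div_div_div_cancel_right₀ hy2 (aeval x l) (aeval x m)]
    exact div_mem (key l hl hlP) (key m hm hmP)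
  · rw [adjoin_simple_le_iff]
    apply IntermediateField.subset_adjoin
    have hhom : ∀ i, (∑ j, C (B i j) * X j : MvPolynomial (Fin 3) K).IsHomogeneous 1 := fun i =>
      IsHomogeneous.sum _ _ _ fun j _ => isHomogeneous_C_mul_X (B i j) j
    have hev : ∀ i, aeval x (∑ j, C (B i j) * X j : MvPolynomial (Fin 3) K) = y i := by
      intro i
      rw [hy]
      simp [Matrix.mulVec, dotProduct]
    have hPz : ∀ i, i ≠ 0 → eval P (∑ j, C (B i j) * X j : MvPolynomial (Fin 3) K) = 0 := by
      intro i hi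
      have := congrFun (congrFun hBA i) 0
      rw [Matrix.mul_apply, Matrix.one_apply_ne hi] at this
      simpa [hP] using this
    exact ⟨_, _, hhom 1, hhom 2, hPz 1 (by decide), hPz 2 (by decide), by rwa [hev],
      by rw [hev, hev]⟩

/-- The ternary quartic form with the coefficient `c i j` at `X₀ ^ (4 - i - j) * X₁ ^ i * X₂ ^ j`;
the values `c i j` with `4 < i + j` are not used. -/
def quartic (c : ℕ → ℕ → K) : MvPolynomial (Fin 3) K :=
  ∑ i ∈ Finset.range 5, ∑ j ∈ Finset.range (5 - i),
    C (c i j) * X 0 ^ (4 - i - j) * X 1 ^ i * X 2 ^ j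

theorem exists_eq_quartic {Q : MvPolynomial (Fin 3) K} (hQ : Q.IsHomogeneous 4) :
    ∃ c : ℕ → ℕ → K, Q = quartic c := by
  let f : (_ : ℕ) × ℕ → (Fin 3 →₀ ℕ) := fun t =>
    Finsupp.equivFunOnFinite.symm ![4 - t.1 - t.2, t.1, t.2]
  refine ⟨fun i j => Q.coeff (f ⟨i, j⟩), ?_⟩
  have hinj : Set.InjOn f ((Finset.range 5).sigma fun i => Finset.range (5 - i)) := by
    rintro ⟨a, b⟩ _ ⟨a', b'⟩ _ h
    have h1 := DFunLike.congr_fun h 1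
    have h2 := DFunLike.congr_fun h 2
    simp [f] at h1 h2
    rw [h1, h2]
  have hsub : Q.support ⊆ ((Finset.range 5).sigma fun i => Finset.range (5 - i)).image f := by
    intro s hs
    have hdeg := hQ (mem_support_iff.1 hs)
    rw [Finsupp.weight_apply, Finsupp.sum_fintype _ _ (by simp), Fin.sum_univ_three] at hdeg
    simp only [Pi.one_apply, smul_eq_mul, mul_one] at hdeg
    simp only [Finset.mem_image, Finset.mem_sigma, Finset.mem_range]
    refine ⟨⟨s 1, s 2⟩, ⟨by simp only; omega, by simp only; omega⟩, ?_⟩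
    ext k
    fin_cases k
    · simp [f]; omega
    · simp [f]
    · simp [f]
  conv_lhs => rw [Q.as_sum]
  rw [Finset.sum_subset hsub (fun s _ hs => by
    rw [notMem_support_iff.1 hs, monomial_zero]), Finset.sum_image hinj, Finset.sum_sigma, quartic]
  refine Finset.sum_congr rfl fun i _ => Finset.sum_congr rfl fun j _ => ?_
  rw [monomial_eq, Finsupp.prod_fintype _ _ (by simp), Fin.prod_univ_three]
  simp [f, mul_assoc]

theorem aeval_quartic {R : Type*} [CommRing R] [Algebra K R] (c : ℕ → ℕ → K) (y : Fin 3 → R) :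
    aeval y (quartic c) =
      algebraMap K R (c 0 0) * y 0 ^ 4 +
      (algebraMap K R (c 1 0) * y 1 + algebraMap K R (c 0 1) * y 2) * y 0 ^ 3 +
      (algebraMap K R (c 2 0) * y 1 ^ 2 + algebraMap K R (c 1 1) * y 1 * y 2 +
        algebraMap K R (c 0 2) * y 2 ^ 2) * y 0 ^ 2 +
      (algebraMap K R (c 3 0) * y 1 ^ 3 + algebraMap K R (c 2 1) * y 1 ^ 2 * y 2 +
        algebraMap K R (c 1 2) * y 1 * y 2 ^ 2 + algebraMap K R (c 0 3) * y 2 ^ 3) * y 0 +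
      (algebraMap K R (c 4 0) * y 1 ^ 4 + algebraMap K R (c 3 1) * y 1 ^ 3 * y 2 +
        algebraMap K R (c 2 2) * y 1 ^ 2 * y 2 ^ 2 + algebraMap K R (c 1 3) * y 1 * y 2 ^ 3 +
        algebraMap K R (c 0 4) * y 2 ^ 4) := by
  simp [quartic, Finset.sum_range_succ]
  ring

/-! ### The degree of the projection from a smooth point -/

/-- The homogenization of degree `N` of a polynomial in `X₁ / X₂`. -/
def homogenizeTwo (N : ℕ) (p : Polynomial K) : MvPolynomial (Fin 3) K :=
  ∑ j ∈ Finset.range (N + 1), C (p.coeff j) * X 1 ^ j * X 2 ^ (N - j)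

theorem homogenizeTwo_isHomogeneous (N : ℕ) (p : Polynomial K) :
    (homogenizeTwo N p).IsHomogeneous N := by
  refine IsHomogeneous.sum _ _ _ fun j hj => ?_
  have h := (((isHomogeneous_C (Fin 3) (p.coeff j)).mul (isHomogeneous_X_pow (R := K) 1 j)).mul
    (isHomogeneous_X_pow (R := K) (2 : Fin 3) (N - j)))
  rwa [show 0 + j + (N - j) = N by rw [Finset.mem_range] at hj; omega] at h

theorem aeval_homogenizeTwo {N : ℕ} {p : Polynomial K} (hp : p.natDegree ≤ N) {y : Fin 3 → E}
    (hy : y 2 ≠ 0) :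
    aeval y (homogenizeTwo N p) = y 2 ^ N * Polynomial.aeval (y 1 / y 2) p := by
  rw [Polynomial.aeval_eq_sum_range' (Nat.lt_succ_of_le hp), homogenizeTwo, map_sum,
    Finset.mul_sum]
  refine Finset.sum_congr rfl fun j hj => ?_
  have hj' : N = (N - j) + j := by rw [Finset.mem_range] at hj; omega
  simp only [map_mul, map_pow, aeval_C, aeval_X, Algebra.smul_def]
  rw [div_pow]
  nth_rw 2 [hj']
  rw [pow_add]
  field_simp

/-- The substitution `X₀ ↦ X`, `X₁ ↦ C X`, `X₂ ↦ 1` into `K[X][X]` undoes the homogenization. -/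
theorem aeval_dehomogenize {N : ℕ} {p : Polynomial K} (hp : p.natDegree ≤ N) :
    aeval ![(Polynomial.X : Polynomial (Polynomial K)), Polynomial.C Polynomial.X, 1]
        (homogenizeTwo N p) =
      Polynomial.C p := by
  conv_rhs => rw [p.as_sum_range' (N + 1) (Nat.lt_succ_of_le hp)]
  rw [homogenizeTwo, map_sum, map_sum]
  refine Finset.sum_congr rfl fun j _ => ?_
  simp [← Polynomial.C_mul_X_pow_eq_monomial, Polynomial.algebraMap_apply]

/-- The generic point does not lie on the line `X₂ = 0`, since a quartic form does not divide a
linear form. -/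
theorem ne_zero_of_isGenericPoint {c : ℕ → ℕ → K} (hc0 : c 0 0 = 0) (hc1 : c 1 0 = 0)
    (hc : c 0 1 ≠ 0) {y : Fin 3 → E}
    (hy : IsGenericPoint (quartic c) y) : y 2 ≠ 0 := by
  intro h
  have hdvd := hy.dvd_of_aeval_eq_zero 1 (X 2) (isHomogeneous_X K 2) (by rwa [aeval_X])
  have hdvd' := map_dvd (aeval ![(Polynomial.X : Polynomial K), 0, 1]) hdvd
  rw [aeval_quartic] at hdvd'
  simp [hc0, hc1] at hdvd'
  have h1 := Polynomial.natDegree_eq_zero_of_isUnit (isUnit_of_dvd_one hdvd')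
  have h2 := Polynomial.natDegree_cubic (b := c 0 2) (c := c 0 3) (d := c 0 4) hc
  rw [h1] at h2
  omega

/-- The projection from a smooth point of a quartic curve has degree three: the third coordinate
satisfies a cubic equation, and none of lower degree since the equation of the curve divides the
homogenization of every relation. -/
theorem finrank_adjoin_eq_three {c : ℕ → ℕ → K} (hc0 : c 0 0 = 0) (hc1 : c 1 0 = 0)
    (hc : c 0 1 ≠ 0) {y : Fin 3 → E} (hy : IsGenericPoint (quartic c) y) :
    Module.finrank K⟮y 1 / y 2⟯ E = 3 := by
  have hy2 := ne_zero_of_isGenericPoint hc0 hc1 hc hy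
  obtain ⟨u, hu⟩ : ∃ u, u = y 1 / y 2 := ⟨_, rfl⟩
  obtain ⟨v, hv⟩ : ∃ v, v = y 0 / y 2 := ⟨_, rfl⟩
  have hy1 : y 1 = y 2 * u := by rw [hu]; field_simp
  have hy0 : y 0 = y 2 * v := by rw [hv]; field_simp
  rw [← hu]
  have hyvec : y = fun i => y 2 * ![v, u, 1] i := by
    funext i; fin_cases i <;> simp [hy0, hy1]
  have htop : K⟮u⟯⟮v⟯ = ⊤ := by
    rw [eq_top_iff]
    intro z _
    obtain ⟨k, Q, R, hQ, hR, h0, rfl⟩ := hy.exists_eq_div z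
    have hmem : ∀ Q : MvPolynomial (Fin 3) K, aeval ![v, u, 1] Q ∈ K⟮u⟯⟮v⟯ := by
      intro Q
      have hvec : ∀ i, ![v, u, 1] i ∈ K⟮u⟯⟮v⟯ := by
        intro i
        fin_cases i
        · exact mem_adjoin_simple_self _ v
        · exact IntermediateField.algebraMap_mem K⟮u⟯⟮v⟯
            (⟨u, mem_adjoin_simple_self K u⟩ : K⟮u⟯)
        · exact one_mem _
      induction Q using MvPolynomial.induction_on with
      | C a =>
        rw [aeval_C]
        exact IntermediateField.algebraMap_mem K⟮u⟯⟮v⟯ (algebraMap K K⟮u⟯ a)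
      | add p q hp hq => rw [map_add]; exact add_mem hp hq
      | mul_X p i hp => rw [map_mul, aeval_X]; exact mul_mem hp (hvec i)
    rw [hyvec, hQ.aeval_mul_left, hR.aeval_mul_left, mul_div_mul_left _ _ (pow_ne_zero k hy2)]
    exact div_mem (hmem Q) (hmem R)
  -- the cubic equation of `v`
  obtain ⟨U, hU⟩ : ∃ U : K⟮u⟯, U = ⟨u, mem_adjoin_simple_self K u⟩ := ⟨_, rfl⟩
  have hUu : algebraMap K⟮u⟯ E U = u := by rw [hU]; rfl
  obtain ⟨g, hg⟩ : ∃ g : Polynomial K⟮u⟯, g =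
      Polynomial.C (algebraMap K K⟮u⟯ (c 0 1)) * Polynomial.X ^ 3 +
      Polynomial.C (algebraMap K _ (c 2 0) * U ^ 2 + algebraMap K _ (c 1 1) * U +
        algebraMap K _ (c 0 2)) * Polynomial.X ^ 2 +
      Polynomial.C (algebraMap K _ (c 3 0) * U ^ 3 + algebraMap K _ (c 2 1) * U ^ 2 +
        algebraMap K _ (c 1 2) * U + algebraMap K _ (c 0 3)) * Polynomial.X +
      Polynomial.C (algebraMap K _ (c 4 0) * U ^ 4 + algebraMap K _ (c 3 1) * U ^ 3 +
        algebraMap K _ (c 2 2) * U ^ 2 + algebraMap K _ (c 1 3) * U + algebraMap K _ (c 0 4)) :=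
    ⟨_, rfl⟩
  have hc' : algebraMap K K⟮u⟯ (c 0 1) ≠ 0 := (map_ne_zero _).2 hc
  have hgdeg : g.natDegree = 3 := by rw [hg]; exact Polynomial.natDegree_cubic hc'
  have hgv : Polynomial.aeval v g = 0 := by
    have h := hy.aeval_eq_zero
    rw [aeval_quartic, hc0, hc1, hy0, hy1] at h
    have hmul : y 2 ^ 4 * Polynomial.aeval v g = 0 := by
      rw [hg]
      simp only [map_add, map_mul, map_pow, Polynomial.aeval_C, Polynomial.aeval_X, hUu,
        ← IsScalarTower.algebraMap_apply]
      rw [← h, map_zero]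
      ring
    exact (mul_eq_zero.1 hmul).resolve_left (pow_ne_zero 4 hy2)
  have hg0 : g ≠ 0 := by rintro h; rw [h] at hgdeg; simp at hgdeg
  have halg : IsAlgebraic K⟮u⟯ v := ⟨g, hg0, hgv⟩
  have hfr : Module.finrank K⟮u⟯ E = (minpoly K⟮u⟯ v).natDegree := by
    rw [← IntermediateField.adjoin.finrank halg.isIntegral, htop, IntermediateField.finrank_top']
  have hle : Module.finrank K⟮u⟯ E ≤ 3 := by
    rw [hfr, ← hgdeg]
    exact Polynomial.natDegree_le_of_dvd (minpoly.dvd _ _ hgv) hg0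
  have hfin : FiniteDimensional K⟮u⟯ E := by
    apply Module.finite_of_finrank_pos
    rw [hfr]
    exact minpoly.natDegree_pos halg.isIntegral
  refine le_antisymm hle ?_
  -- `1, v, v ^ 2` are independent over `K[u]`: the quartic would divide the homogenization of a
  -- relation, which has degree at most two in `X₀`
  have hind : LinearIndependent (Algebra.adjoin K {u}) (fun i : Fin 3 => v ^ (i : ℕ)) := by
    rw [Fintype.linearIndependent_iff]
    intro r hr
    have hp : ∀ i, ∃ p : Polynomial K, (r i : E) = Polynomial.aeval u p := by
      intro i
      obtain ⟨p, hp⟩ := (Algebra.adjoin_singleton_eq_range_aeval K u).le (r i).2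
      exact ⟨p, hp.symm⟩
    choose p hp using hp
    obtain ⟨N, hN⟩ : ∃ N, ∀ i, (p i).natDegree ≤ N :=
      ⟨∑ i, (p i).natDegree, fun i => Finset.single_le_sum
        (f := fun i => (p i).natDegree) (fun _ _ => Nat.zero_le _) (Finset.mem_univ i)⟩
    obtain ⟨Q, hQ⟩ : ∃ Q : MvPolynomial (Fin 3) K, Q = homogenizeTwo (N + 2) (p 0) +
        X 0 ^ 1 * homogenizeTwo (N + 1) (p 1) + X 0 ^ 2 * homogenizeTwo N (p 2) := ⟨_, rfl⟩
    have hQhom : Q.IsHomogeneous (N + 2) := by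
      rw [hQ]
      refine ((homogenizeTwo_isHomogeneous _ _).add ?_).add ?_
      · have := (isHomogeneous_X_pow (R := K) (0 : Fin 3) 1).mul
          (homogenizeTwo_isHomogeneous (N + 1) (p 1))
        rwa [show 1 + (N + 1) = N + 2 by ring] at this
      · have := (isHomogeneous_X_pow (R := K) (0 : Fin 3) 2).mul
          (homogenizeTwo_isHomogeneous N (p 2))
        rwa [show 2 + N = N + 2 by ring] at this
    have hQ0 : aeval y Q = 0 := by
      have hr' : Polynomial.aeval u (p 0) + v * Polynomial.aeval u (p 1) +
          v ^ 2 * Polynomial.aeval u (p 2) = 0 := by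
        rw [Fin.sum_univ_three] at hr
        simp only [Algebra.smul_def, Subalgebra.algebraMap_def, hp] at hr
        rw [← hr]
        simp
        ring
      rw [hQ]
      simp only [map_add, map_mul, map_pow, aeval_X]
      rw [aeval_homogenizeTwo ((hN 0).trans (by omega)) hy2,
        aeval_homogenizeTwo ((hN 1).trans (by omega)) hy2, aeval_homogenizeTwo (hN 2) hy2, ← hu,
        hy0]
      linear_combination y 2 ^ (N + 2) * hr'
    have hdvd := map_dvd (aeval ![(Polynomial.X : Polynomial (Polynomial K)),
      Polynomial.C Polynomial.X, 1]) (hy.dvd_of_aeval_eq_zero _ Q hQhom hQ0)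
    have hQd : aeval ![(Polynomial.X : Polynomial (Polynomial K)),
        Polynomial.C Polynomial.X, 1] Q = Polynomial.C (p 2) * Polynomial.X ^ 2 +
        Polynomial.C (p 1) * Polynomial.X + Polynomial.C (p 0) := by
      rw [hQ]
      simp only [map_add, map_mul, map_pow, aeval_X]
      rw [aeval_dehomogenize ((hN 0).trans (Nat.le_add_right N 2)),
        aeval_dehomogenize ((hN 1).trans (Nat.le_add_right N 1)), aeval_dehomogenize (hN 2)]
      simp
      ring
    have hF : aeval ![(Polynomial.X : Polynomial (Polynomial K)),
        Polynomial.C Polynomial.X, 1] (quartic c) =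
        Polynomial.C (Polynomial.C (c 0 1)) * Polynomial.X ^ 3 +
        Polynomial.C (Polynomial.C (c 2 0) * Polynomial.X ^ 2 +
          Polynomial.C (c 1 1) * Polynomial.X + Polynomial.C (c 0 2)) * Polynomial.X ^ 2 +
        Polynomial.C (Polynomial.C (c 3 0) * Polynomial.X ^ 3 +
          Polynomial.C (c 2 1) * Polynomial.X ^ 2 +
          Polynomial.C (c 1 2) * Polynomial.X + Polynomial.C (c 0 3)) * Polynomial.X +
        Polynomial.C (Polynomial.C (c 4 0) * Polynomial.X ^ 4 +
          Polynomial.C (c 3 1) * Polynomial.X ^ 3 + Polynomial.C (c 2 2) * Polynomial.X ^ 2 +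
          Polynomial.C (c 1 3) * Polynomial.X + Polynomial.C (c 0 4)) := by
      rw [aeval_quartic, hc0, hc1]
      simp [Polynomial.algebraMap_apply]
    have hzero := Polynomial.eq_zero_of_dvd_of_natDegree_lt hdvd (by
      rw [hF, Polynomial.natDegree_cubic (by simpa using hc), hQd]
      exact lt_of_le_of_lt Polynomial.natDegree_quadratic_le (by norm_num))
    rw [hQd] at hzero
    intro i
    have hpi : p i = 0 := by
      have := congrArg (fun q => Polynomial.coeff q (i : ℕ)) hzero
      fin_cases i <;> simpa [Polynomial.coeff_X, Polynomial.coeff_C] using this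
    apply Subtype.ext
    rw [hp, hpi, map_zero]
    rfl
  open algebraAdjoinAdjoin in
  have hind' := (LinearIndependent.iff_fractionRing (Algebra.adjoin K {u}) K⟮u⟯).1 hind
  simpa using hind'.fintype_card_le_finrank

/-! ### Coordinates at a smooth point -/

/-- The chain rule along a polynomial curve. -/
theorem derivative_aeval (F : MvPolynomial (Fin 3) K) (f : Fin 3 → Polynomial K) :
    Polynomial.derivative (aeval f F) =
      ∑ i, aeval f (pderiv i F) * Polynomial.derivative (f i) := by
  induction F using MvPolynomial.induction_on with
  | C a => simp [Polynomial.algebraMap_eq]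
  | add p q hp hq => simp only [map_add, hp, hq, add_mul, Finset.sum_add_distrib]
  | mul_X p j hp =>
    have hterm : ∀ i, aeval f (pderiv i (p * X j)) =
        aeval f (pderiv i p) * f j + aeval f p * (if i = j then 1 else 0) := by
      intro i
      rw [pderiv_mul, map_add, map_mul, map_mul, aeval_X, pderiv_X, Pi.single_apply]
      congr 2
      by_cases h : i = j
      · rw [if_pos h, if_pos h.symm, map_one]
      · rw [if_neg h, if_neg (Ne.symm h), map_zero]
    rw [map_mul, aeval_X, Polynomial.derivative_mul, hp, Finset.sum_mul]
    simp only [hterm, add_mul, Finset.sum_add_distrib, mul_ite, mul_one, mul_zero, ite_mul,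
      zero_mul, Finset.sum_ite_eq', Finset.mem_univ, if_true]
    rw [add_right_cancel_iff]
    exact Finset.sum_congr rfl fun i _ => by ring

variable {d : ℕ}

theorem eval_zero_aeval (F : MvPolynomial (Fin 3) K) (a v : Fin 3 → K) :
    (aeval (fun i => Polynomial.C (a i) + Polynomial.C (v i) * Polynomial.X) F).eval 0 =
      eval a F := by
  rw [← Polynomial.coe_aeval_eq_eval, comp_aeval_apply]
  simp only [map_add, map_mul, Polynomial.aeval_C, Polynomial.aeval_X, mul_zero, add_zero]
  exact congrFun (congrArg DFunLike.coe (coe_aeval_eq_eval a)) F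

theorem restrict_coeff_zero (C : PlaneCurve K d) (a v : Fin 3 → K) :
    (C.restrict a v).coeff 0 = eval a C.form := by
  rw [Polynomial.coeff_zero_eq_eval_zero, restrict, eval_zero_aeval]

theorem restrict_coeff_one (C : PlaneCurve K d) (a v : Fin 3 → K) :
    (C.restrict a v).coeff 1 = ∑ i, eval a (pderiv i C.form) * v i := by
  have h : (C.restrict a v).coeff 1 = (Polynomial.derivative (C.restrict a v)).eval 0 := by
    rw [← Polynomial.coeff_zero_eq_eval_zero, Polynomial.coeff_derivative]
    simp
  rw [h, restrict, derivative_aeval, Polynomial.eval_finsetSum]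
  refine Finset.sum_congr rfl fun i _ => ?_
  rw [Polynomial.eval_mul, eval_zero_aeval]
  simp

/-- A nonzero vector `P` in the kernel of a nonzero functional `φ` extends to a basis `P, v, w` of
`K³` such that `P, v` is a basis of the kernel. -/
theorem exists_basis_of_functional (φ : (Fin 3 → K) →ₗ[K] K) (hφ : φ ≠ 0) {P : Fin 3 → K}
    (hP : P ≠ 0) (hφP : φ P = 0) :
    ∃ v w : Fin 3 → K, φ v = 0 ∧ φ w ≠ 0 ∧ LinearIndependent K ![P, v, w] ∧
      v ∉ Submodule.span K {P} ∧
      ∀ v', φ v' = 0 → v' ∉ Submodule.span K {P} → ∃ b c : K, c ≠ 0 ∧ v' = b • P + c • v := by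
  have hsurj : Function.Surjective φ := LinearMap.surjective hφ
  have hker : Module.finrank K (LinearMap.ker φ) = 2 := by
    have := φ.finrank_range_add_finrank_ker
    rw [LinearMap.range_eq_top.2 hsurj, finrank_top, Module.finrank_self,
      Module.finrank_fin_fun] at this
    omega
  have hspan : Module.finrank K (Submodule.span K {P}) = 1 := finrank_span_singleton hP
  obtain ⟨v, hv, hvP⟩ : ∃ v ∈ LinearMap.ker φ, v ∉ Submodule.span K {P} := by
    by_contra! h
    have := Submodule.finrank_mono (show LinearMap.ker φ ≤ Submodule.span K {P} from h)
    omega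
  obtain ⟨w, hw⟩ : ∃ w, φ w ≠ 0 := by
    by_contra! h
    exact hφ (LinearMap.ext h)
  have hv0 : φ v = 0 := hv
  have hPv : LinearIndependent K ![P, v] := by
    rw [LinearIndependent.pair_iff' hP]
    intro a h
    exact hvP (h ▸ Submodule.smul_mem _ _ (Submodule.mem_span_singleton_self P))
  have heq : Submodule.span K {P, v} = LinearMap.ker φ := by
    apply Submodule.eq_of_le_of_finrank_eq
    · rw [Submodule.span_le]
      rintro x (rfl | rfl)
      · exact hφP
      · exact hv0
    · have := finrank_span_eq_card hPv
      rw [hker]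
      rw [Matrix.range_cons_cons_empty] at this
      simpa using this
  refine ⟨v, w, hv0, hw, ?_, hvP, ?_⟩
  · rw [Fintype.linearIndependent_iff]
    intro g hg
    simp [Fin.sum_univ_three] at hg
    have h2 : g 2 = 0 := by
      have := congrArg φ hg
      simp only [map_add, map_smul, hφP, hv0, smul_eq_mul, mul_zero, zero_add, map_zero] at this
      exact (mul_eq_zero.1 this).resolve_right hw
    rw [h2, zero_smul, add_zero] at hg
    obtain ⟨h0, h1⟩ := LinearIndependent.pair_iff.1 hPv _ _ hg
    intro i
    fin_cases i <;> assumption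
  · intro v' h0 hv'
    have hmem : v' ∈ Submodule.span K {P, v} := by rw [heq]; exact h0
    rw [Submodule.mem_span_pair] at hmem
    obtain ⟨b, c, hbc⟩ := hmem
    refine ⟨b, c, ?_, hbc.symm⟩
    rintro rfl
    apply hv'
    rw [← hbc, zero_smul, add_zero]
    exact Submodule.smul_mem _ _ (Submodule.mem_span_singleton_self P)

/-- Adapted coordinates at a smooth point `P`: the columns of `A` are `P`, a second point of the
tangent line, and a point off the tangent line. In these coordinates the equation of the curve has
no terms `X₀ ^ 4` and `X₀ ^ 3 * X₁`, it has a term `X₀ ^ 3 * X₂`, and the coefficients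
`c i 0` describe the intersection with the tangent line `X₂ = 0`. -/
theorem exists_adapted_coordinates (Q : PlaneCurve K 4) (P : ℙ K (Fin 3 → K))
    (hP : Q.IsSmoothPoint P) :
    ∃ (A B : Matrix (Fin 3) (Fin 3) K) (c : ℕ → ℕ → K), A * B = 1 ∧ B * A = 1 ∧
      (∀ i, A i 0 = P.rep i) ∧ linSubst A Q.form = quartic c ∧ c 0 0 = 0 ∧ c 1 0 = 0 ∧
      c 0 1 ≠ 0 ∧ Q.tangentMultiplicity P = emultiplicity Polynomial.X
        (Polynomial.C (c 2 0) * Polynomial.X ^ 2 + Polynomial.C (c 3 0) * Polynomial.X ^ 3 +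
          Polynomial.C (c 4 0) * Polynomial.X ^ 4) := by
  obtain ⟨hPC, i₀, hi₀⟩ := hP
  let φ : (Fin 3 → K) →ₗ[K] K :=
    ∑ i, eval P.rep (pderiv i Q.form) • LinearMap.proj (R := K) (φ := fun _ => K) i
  have hφ : ∀ v, φ v = ∑ i, eval P.rep (pderiv i Q.form) * v i := by
    intro v; simp [φ, LinearMap.sum_apply]
  have hφ0 : φ ≠ 0 := by
    intro h
    apply hi₀
    have := hφ (Pi.single i₀ 1)
    rw [h] at this
    simpa [Pi.single_apply] using this.symm
  -- Euler's identity: `P` lies on its tangent line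
  have hφP : φ P.rep = 0 := by
    rw [hφ]
    have h := congrArg (eval P.rep) Q.isHomogeneous.sum_X_mul_pderiv
    rw [map_sum, map_nsmul, show eval P.rep Q.form = 0 from hPC, smul_zero] at h
    rw [← h]
    refine Finset.sum_congr rfl fun i _ => ?_
    rw [map_mul, eval_X, mul_comm]
  obtain ⟨v, w, hv, hw, hind, hvP, hall⟩ :=
    exists_basis_of_functional φ hφ0 P.rep_nonzero hφP
  let A : Matrix (Fin 3) (Fin 3) K := (Matrix.of ![P.rep, v, w])ᵀ
  have hA : IsUnit A := by
    rw [Matrix.isUnit_transpose]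
    exact Matrix.linearIndependent_rows_iff_isUnit.1 hind
  have hdet : IsUnit A.det := (Matrix.isUnit_iff_isUnit_det A).1 hA
  obtain ⟨c, hc⟩ := exists_eq_quartic (linSubst_isHomogeneous A Q.isHomogeneous)
  have hrestrict : ∀ s t : K, Q.restrict P.rep (s • v + t • w) =
      aeval ![1, Polynomial.C s * Polynomial.X, Polynomial.C t * Polynomial.X] (quartic c) := by
    intro s t
    rw [← hc, aeval_linSubst, restrict]
    congr 2
    funext i
    simp [Matrix.mulVec, dotProduct, Fin.sum_univ_three, A, Polynomial.algebraMap_eq]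
    ring
  have hrv : Q.restrict P.rep v = Polynomial.C (c 0 0) + Polynomial.C (c 1 0) * Polynomial.X +
      Polynomial.C (c 2 0) * Polynomial.X ^ 2 + Polynomial.C (c 3 0) * Polynomial.X ^ 3 +
        Polynomial.C (c 4 0) * Polynomial.X ^ 4 := by
    have := hrestrict 1 0
    rw [one_smul, zero_smul, add_zero, aeval_quartic] at this
    rw [this]
    simp [Polynomial.algebraMap_eq]
  have hc0 : c 0 0 = 0 := by
    have := Q.restrict_coeff_zero P.rep v
    rw [hrv, show eval P.rep Q.form = 0 from hPC] at this
    simpa using this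
  have hc1 : c 1 0 = 0 := by
    have := Q.restrict_coeff_one P.rep v
    rw [hrv, ← hφ, hv] at this
    simpa [Polynomial.coeff_C] using this
  refine ⟨A, A⁻¹, c, Matrix.mul_nonsing_inv A hdet, Matrix.nonsing_inv_mul A hdet, ?_, hc, hc0,
    hc1, ?_, ?_⟩
  · intro i; simp [A]
  · have hrw := hrestrict 0 1
    rw [one_smul, zero_smul, zero_add, aeval_quartic] at hrw
    have h1 := Q.restrict_coeff_one P.rep w
    rw [← hφ, hrw] at h1
    intro h01
    apply hw
    rw [← h1, hc0, h01]
    simp [Polynomial.algebraMap_eq, Polynomial.coeff_X_pow]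
  · have hmult : Q.lineMultiplicity P.rep v = emultiplicity Polynomial.X
        (Polynomial.C (c 2 0) * Polynomial.X ^ 2 + Polynomial.C (c 3 0) * Polynomial.X ^ 3 +
          Polynomial.C (c 4 0) * Polynomial.X ^ 4) := by
      rw [lineMultiplicity, hrv, hc0, hc1]
      simp
    rw [← hmult, tangentMultiplicity]
    have htan : ∀ v, v ∈ Q.tangentLine P ↔ φ v = 0 := by
      intro v; rw [hφ]; rfl
    apply le_antisymm
    · exact iInf₂_le v ⟨(htan v).2 hv, hvP⟩
    · refine le_iInf₂ fun v' hv' => ?_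
      obtain ⟨b, e, he, rfl⟩ := hall v' ((htan v').1 hv'.1) hv'.2
      rw [lineMultiplicity_eq _ _ _ _ _ he]

/-! ### The generic point of a plane curve -/

theorem toFrac_eq_zero_iff (Q : PlaneCurve K d) (G : MvPolynomial (Fin 3) K) :
    Q.toFrac G = 0 ↔ Q.form ∣ G := by
  have : Q.toFrac G = algebraMap Q.CoordRing _ (Ideal.Quotient.mk _ G) := rfl
  rw [this, map_eq_zero_iff _ (IsFractionRing.injective Q.CoordRing _),
    Ideal.Quotient.eq_zero_iff_mem, Ideal.mem_span_singleton]

/-- The ratios of the coordinate functions are a generic point over the function field. -/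
theorem exists_isGenericPoint (Q : PlaneCurve K d) (hd : 1 < d) :
    ∃ x : Fin 3 → Q.functionField, IsGenericPoint Q.form x ∧
      ∀ P : ℙ K (Fin 3 → K), projField x P.rep = Q.projectionField P := by
  have hX : Q.toFrac (X 0) ≠ 0 := by
    rw [Ne, toFrac_eq_zero_iff]
    rintro ⟨G, hG⟩
    have hG0 : G ≠ 0 := by rintro rfl; rw [mul_zero] at hG; exact X_ne_zero 0 hG
    have h1 := congrArg totalDegree hG
    rw [totalDegree_X, totalDegree_mul_of_isDomain Q.irreducible.ne_zero hG0,
      Q.isHomogeneous.totalDegree Q.irreducible.ne_zero] at h1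
    omega
  let x : Fin 3 → Q.functionField := fun i =>
    ⟨Q.toFrac (X i) / Q.toFrac (X 0), 1, X i, X 0, isHomogeneous_X K i, isHomogeneous_X K 0, hX,
      rfl⟩
  have hx : ∀ (k : ℕ) (G : MvPolynomial (Fin 3) K), G.IsHomogeneous k →
      ((aeval x G : Q.functionField) : FractionRing Q.CoordRing) =
        (Q.toFrac (X 0))⁻¹ ^ k * Q.toFrac G := by
    intro k G hG
    have h1 := comp_aeval_apply (R := K) x Q.functionField.val G
    have h2 : Q.toFrac G = aeval (fun i => Q.toFrac (X i)) G := by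
      rw [← comp_aeval_apply, aeval_X_left_apply]
    rw [h2, ← hG.aeval_mul_left]
    refine h1.trans ?_
    congr 2
    funext i
    exact div_eq_inv_mul _ _
  have hinv : ∀ k : ℕ, (Q.toFrac (X 0))⁻¹ ^ k ≠ 0 := fun k => pow_ne_zero k (inv_ne_zero hX)
  have hx0 : ∀ (k : ℕ) (G : MvPolynomial (Fin 3) K), G.IsHomogeneous k →
      (aeval x G = 0 ↔ Q.toFrac G = 0) := by
    intro k G hG
    rw [← ZeroMemClass.coe_eq_zero, hx k G hG, mul_eq_zero, or_iff_right (hinv k)]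
  have hdiv : ∀ (k : ℕ) (G H : MvPolynomial (Fin 3) K), G.IsHomogeneous k → H.IsHomogeneous k →
      ((aeval x G / aeval x H : Q.functionField) : FractionRing Q.CoordRing) =
        Q.toFrac G / Q.toFrac H := by
    intro k G H hG hH
    rw [IntermediateField.coe_div, hx k G hG, hx k H hH, mul_div_mul_left _ _ (hinv k)]
  refine ⟨x, ⟨?_, ?_, ?_⟩, ?_⟩
  · rw [hx0 d _ Q.isHomogeneous, toFrac_eq_zero_iff]
  · intro k G hG h
    rwa [hx0 k G hG, toFrac_eq_zero_iff] at h
  · rintro ⟨z, k, G, H, hG, hH, h0, hz⟩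
    exact ⟨k, G, H, hG, hH, (hx0 k H hH).not.2 h0, Subtype.ext (hz.trans (hdiv k G H hG hH).symm)⟩
  · intro P
    rw [projField, projectionField]
    congr 1
    ext z
    refine exists_congr fun l => exists_congr fun m => and_congr_right fun hl =>
      and_congr_right fun hm => and_congr_right fun _ => and_congr_right fun _ => ?_
    rw [Ne, hx0 1 m hm, ← hdiv 1 l m hl hm, Subtype.ext_iff]

/-! ### Parametrization of a quartic with a total flex Galois point -/

theorem coeffs_of_emultiplicity_eq_four {a b e : K}
    (h : emultiplicity Polynomial.X (Polynomial.C a * Polynomial.X ^ 2 +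
      Polynomial.C b * Polynomial.X ^ 3 + Polynomial.C e * Polynomial.X ^ 4) = 4) :
    a = 0 ∧ b = 0 ∧ e ≠ 0 := by
  have hdvd := pow_dvd_of_le_emultiplicity (k := 4) (by rw [h]; rfl)
  rw [Polynomial.X_pow_dvd_iff] at hdvd
  have ha : a = 0 := by simpa [Polynomial.coeff_X_pow] using hdvd 2 (by norm_num)
  have hb : b = 0 := by simpa [Polynomial.coeff_X_pow] using hdvd 3 (by norm_num)
  refine ⟨ha, hb, ?_⟩
  rintro rfl
  rw [ha, hb] at h
  simp at h

theorem coeff_ne_zero_of_emultiplicity_eq_two {a b e : K}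
    (h : emultiplicity Polynomial.X (Polynomial.C a * Polynomial.X ^ 2 +
      Polynomial.C b * Polynomial.X ^ 3 + Polynomial.C e * Polynomial.X ^ 4) = 2) : a ≠ 0 := by
  rintro rfl
  have hdvd : (Polynomial.X : Polynomial K) ^ 3 ∣ Polynomial.C 0 * Polynomial.X ^ 2 +
      Polynomial.C b * Polynomial.X ^ 3 + Polynomial.C e * Polynomial.X ^ 4 :=
    ⟨Polynomial.C b + Polynomial.C e * Polynomial.X, by rw [map_zero]; ring⟩
  have := le_emultiplicity_of_pow_dvd hdvd
  rw [h] at this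
  exact absurd this (by decide)

/-- A rational quartic curve with a Galois point at which the tangent line meets the curve four
times has a parametrization `P q + v (a X ^ 3 + b) + w`, where `q` is a polynomial of degree four
and `P, v, w` are the columns of a matrix of adapted coordinates. -/
theorem exists_parametrization [IsAlgClosed K] (h3 : (3 : K) ≠ 0)
    {F : MvPolynomial (Fin 3) K} {x : Fin 3 → RatFunc K} (hx : IsGenericPoint F x)
    {P : Fin 3 → K} [IsGalois (projField x P) (RatFunc K)]
    {A B : Matrix (Fin 3) (Fin 3) K} {c : ℕ → ℕ → K} (hAB : A * B = 1) (hBA : B * A = 1)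
    (hP : ∀ i, A i 0 = P i) (hc : linSubst A F = quartic c) (hc00 : c 0 0 = 0) (hc10 : c 1 0 = 0)
    (hc01 : c 0 1 ≠ 0) (hc20 : c 2 0 = 0) (hc30 : c 3 0 = 0) (hc40 : c 4 0 ≠ 0) :
    ∃ (θ : RatFunc K ≃ₐ[K] RatFunc K) (s : RatFunc K) (a b : K) (q : Polynomial K),
      s ≠ 0 ∧ q.natDegree = 4 ∧ ∀ i, θ (x i) = s * algebraMap _ _ ((A.map Polynomial.C *ᵥ
        ![q, Polynomial.C a * Polynomial.X ^ 3 + Polynomial.C b, 1]) i) := by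
  obtain ⟨y, hy⟩ : ∃ y, y = B.map (algebraMap K (RatFunc K)) *ᵥ x := ⟨_, rfl⟩
  have hgen : IsGenericPoint (quartic c) y := by
    rw [← hc, hy]; exact hx.linSubst hAB hBA
  have hy2 := ne_zero_of_isGenericPoint hc00 hc10 hc01 hgen
  have hfr := finrank_adjoin_eq_three hc00 hc10 hc01 hgen
  have hproj := projField_eq_adjoin hAB hBA hP hy hy2
  have hgal : IsGalois K⟮y 1 / y 2⟯ (RatFunc K) := hproj ▸ ‹_›
  obtain ⟨θ₁, α, β, γ, δ, hdet, hmoeb⟩ :=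
    RatFunc.exists_algEquiv_eq_cube_moebius h3 (y 1 / y 2) hfr
  obtain ⟨u, hu⟩ : ∃ u, u = y 1 / y 2 := ⟨_, rfl⟩
  obtain ⟨v, hv⟩ : ∃ v, v = y 0 / y 2 := ⟨_, rfl⟩
  have hy1 : y 1 = y 2 * u := by rw [hu]; field_simp
  have hy0 : y 0 = y 2 * v := by rw [hv]; field_simp
  rw [← hu] at hmoeb
  have hcubic : RatFunc.C (c 0 1) * v ^ 3 + (RatFunc.C (c 0 2) + RatFunc.C (c 1 1) * u) * v ^ 2 +
      (RatFunc.C (c 0 3) + RatFunc.C (c 1 2) * u + RatFunc.C (c 2 1) * u ^ 2) * v +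
      (RatFunc.C (c 0 4) + RatFunc.C (c 1 3) * u + RatFunc.C (c 2 2) * u ^ 2 +
        RatFunc.C (c 3 1) * u ^ 3 + RatFunc.C (c 4 0) * u ^ 4) = 0 := by
    have h := hgen.aeval_eq_zero
    rw [aeval_quartic, hc00, hc10, hc20, hc30, hy0, hy1] at h
    simp only [RatFunc.algebraMap_eq_C, map_zero] at h
    refine (mul_eq_zero.1 ?_).resolve_left (pow_ne_zero 4 hy2)
    rw [← h]
    ring
  have hcubic₁ := congrArg θ₁ hcubic
  simp only [map_add, map_mul, map_pow, RatFunc.algEquiv_C, map_zero] at hcubic₁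
  obtain ⟨θ₂, a, b, q, ha, hq, hua, hvq⟩ :=
    RatFunc.exists_parameter_of_cubic h3 hc01 hc40 hcubic₁ hdet hmoeb
  refine ⟨θ₁.trans θ₂, θ₂ (θ₁ (y 2)), a, b, q, ?_, hq, fun i => ?_⟩
  · exact fun h => hy2 ((θ₁.trans θ₂).injective (h.trans (map_zero _).symm))
  · have hxi : x i = ∑ j, RatFunc.C (A i j) * y j := by
      have := congrFun (map_mul_mulVec hAB x) i
      rw [← hy] at this
      rw [← this]
      simp [Matrix.mulVec, dotProduct]
    rw [hxi, Fin.sum_univ_three, hy0, hy1]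
    simp only [AlgEquiv.trans_apply, map_add, map_mul, RatFunc.algEquiv_C, hua, hvq,
      Matrix.mulVec, dotProduct, Fin.sum_univ_three, Matrix.map_apply]
    simp
    ring

/-! ### The pencil of lines through a second Galois point -/

/-- A fraction of two polynomials that is a Möbius transform of the cube of a generator of
`K(X)` has, up to a common factor, cubes of affine functions as numerator and denominator after a
linear change. -/
theorem exists_cubes {l m : Polynomial K} (hm : m ≠ 0) {s : RatFunc K} (hs : K⟮s⟯ = ⊤)
    {α β γ δ : K} (hdet : α * δ - β * γ ≠ 0)
    (h : algebraMap _ (RatFunc K) l / algebraMap _ _ m *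
      (RatFunc.C γ * s ^ 3 + RatFunc.C δ) = RatFunc.C α * s ^ 3 + RatFunc.C β) :
    ∃ L M N : Polynomial K, IsCoprime L M ∧ max L.natDegree M.natDegree = 1 ∧
      l = N * (Polynomial.C α * L ^ 3 + Polynomial.C β * M ^ 3) ∧
      m = N * (Polynomial.C γ * L ^ 3 + Polynomial.C δ * M ^ 3) := by
  have hmax := RatFunc.max_natDegree_of_adjoin_eq_top hs
  have hcop := RatFunc.isCoprime_num_denom s
  have hM := RatFunc.denom_ne_zero s
  have hsLM := RatFunc.num_div_denom s
  obtain ⟨L, hL⟩ : ∃ L, L = s.num := ⟨_, rfl⟩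
  obtain ⟨M, hM'⟩ : ∃ M, M = s.denom := ⟨_, rfl⟩
  rw [← hL, ← hM'] at hmax hcop hsLM
  rw [← hM'] at hM
  have hL0 : L ≠ 0 := by
    rintro rfl
    apply RatFunc.ne_C_of_adjoin_eq_top hs
    exact ⟨0, by rw [← hsLM]; simp⟩
  have hpoly : l * (Polynomial.C γ * L ^ 3 + Polynomial.C δ * M ^ 3) =
      m * (Polynomial.C α * L ^ 3 + Polynomial.C β * M ^ 3) := by
    apply RatFunc.algebraMap_injective K
    have hm' := RatFunc.algebraMap_ne_zero hm
    have hM' := RatFunc.algebraMap_ne_zero hM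
    rw [← hsLM] at h
    simp only [map_mul, map_add, map_pow, RatFunc.algebraMap_C]
    field_simp at h
    linear_combination h
  obtain ⟨D, hD⟩ : ∃ D : Polynomial K, D * (Polynomial.C α * Polynomial.C δ -
      Polynomial.C β * Polynomial.C γ) = 1 := by
    refine ⟨Polynomial.C (α * δ - β * γ)⁻¹, ?_⟩
    rw [← map_mul, ← map_mul, ← map_sub, ← map_mul, inv_mul_cancel₀ hdet, map_one]
  have hcross : (Polynomial.C δ * l - Polynomial.C β * m) * M ^ 3 =
      (Polynomial.C α * m - Polynomial.C γ * l) * L ^ 3 := by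
    linear_combination hpoly
  obtain ⟨N, hN⟩ : L ^ 3 ∣ Polynomial.C δ * l - Polynomial.C β * m :=
    (hcop.pow (m := 3) (n := 3)).dvd_of_dvd_mul_right (Dvd.intro_left _ hcross.symm)
  have hN' : Polynomial.C α * m - Polynomial.C γ * l = N * M ^ 3 := by
    apply mul_right_cancel₀ (pow_ne_zero 3 hL0)
    rw [← hcross, hN]
    ring
  refine ⟨L, M, D * N, hcop, hmax, ?_, ?_⟩
  · linear_combination (-l) * hD + D *
      (Polynomial.C α * hN + Polynomial.C β * hN')
  · linear_combination (-m) * hD + D *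
      (Polynomial.C γ * hN + Polynomial.C δ * hN')

/-- Let `τ` be the root of the common factor of `y 1` and `y 2`, that is, a parameter of the centre
`(1 : 0 : 0)` of the projection. If the projection is totally ramified at `τ`, then the tangent
line `X₂ = 0` meets the curve more than twice at the centre, so that `c 2 0` vanishes. -/
theorem false_of_common_root {c : ℕ → ℕ → K} (hc00 : c 0 0 = 0) (hc10 : c 1 0 = 0)
    (hc01 : c 0 1 ≠ 0) (hc20 : c 2 0 ≠ 0) {y : Fin 3 → Polynomial K}
    (hy : aeval y (quartic c) = 0) {τ : K} (hτ : ∃ j, (y j).eval τ ≠ 0)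
    {M : Polynomial K} (hM : M.eval τ ≠ 0) {n l α β γ δ : K} (hn : n ≠ 0)
    (hdet : α * δ - β * γ ≠ 0)
    (hy1 : y 1 = Polynomial.C n * (Polynomial.X - Polynomial.C τ) *
      (Polynomial.C α * (Polynomial.C l * (Polynomial.X - Polynomial.C τ)) ^ 3 +
        Polynomial.C β * M ^ 3))
    (hy2 : y 2 = Polynomial.C n * (Polynomial.X - Polynomial.C τ) *
      (Polynomial.C γ * (Polynomial.C l * (Polynomial.X - Polynomial.C τ)) ^ 3 +
        Polynomial.C δ * M ^ 3)) : False := by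
  obtain ⟨π, hπ⟩ : ∃ π : Polynomial K, π = Polynomial.X - Polynomial.C τ := ⟨_, rfl⟩
  have hπτ : π.eval τ = 0 := by rw [hπ]; simp
  have hπ0 : π ≠ 0 := by rw [hπ]; exact Polynomial.X_sub_C_ne_zero τ
  rw [← hπ] at hy1 hy2
  have h0 : (y 0).eval τ ≠ 0 := by
    obtain ⟨j, hj⟩ := hτ
    fin_cases j
    · exact hj
    · exact absurd (by simp [hy1, hπτ]) hj
    · exact absurd (by simp [hy2, hπτ]) hj
  obtain ⟨Y₁, hY₁⟩ : ∃ Y, Y = Polynomial.C n * (Polynomial.C α * (Polynomial.C l * π) ^ 3 +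
    Polynomial.C β * M ^ 3) := ⟨_, rfl⟩
  obtain ⟨Y₂, hY₂⟩ : ∃ Y, Y = Polynomial.C n * (Polynomial.C γ * (Polynomial.C l * π) ^ 3 +
    Polynomial.C δ * M ^ 3) := ⟨_, rfl⟩
  have hy1' : y 1 = π * Y₁ := by rw [hy1, hY₁]; ring
  have hy2' : y 2 = π * Y₂ := by rw [hy2, hY₂]; ring
  rw [aeval_quartic, hc00, hc10, hy1', hy2'] at hy
  simp only [Polynomial.algebraMap_eq, map_zero] at hy
  -- the equation modulo `π ^ 2`
  have hδ : δ = 0 := by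
    have hfirst : Polynomial.C (c 0 1) * Y₂ * y 0 ^ 3 + π *
        ((Polynomial.C (c 2 0) * Y₁ ^ 2 + Polynomial.C (c 1 1) * Y₁ * Y₂ +
          Polynomial.C (c 0 2) * Y₂ ^ 2) * y 0 ^ 2 +
        π * (Polynomial.C (c 3 0) * Y₁ ^ 3 + Polynomial.C (c 2 1) * Y₁ ^ 2 * Y₂ +
          Polynomial.C (c 1 2) * Y₁ * Y₂ ^ 2 + Polynomial.C (c 0 3) * Y₂ ^ 3) * y 0 +
        π ^ 2 * (Polynomial.C (c 4 0) * Y₁ ^ 4 + Polynomial.C (c 3 1) * Y₁ ^ 3 * Y₂ +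
          Polynomial.C (c 2 2) * Y₁ ^ 2 * Y₂ ^ 2 + Polynomial.C (c 1 3) * Y₁ * Y₂ ^ 3 +
          Polynomial.C (c 0 4) * Y₂ ^ 4)) = 0 := by
      apply mul_left_cancel₀ hπ0
      rw [mul_zero, ← hy]
      ring
    have h1 := congrArg (Polynomial.eval τ) hfirst
    simpa [hπτ, hc01, h0, hY₂, hn, hM] using h1
  obtain ⟨Z, hZ⟩ : ∃ Z : Polynomial K, Z = Polynomial.C n * Polynomial.C γ *
    Polynomial.C l ^ 3 := ⟨_, rfl⟩
  have hYZ : Y₂ = π ^ 3 * Z := by rw [hY₂, hZ, hδ, map_zero]; ring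
  have hβ : β ≠ 0 := by rintro rfl; simp [hδ] at hdet
  -- the equation modulo `π ^ 3`, where now `y 2` vanishes to order at least four at `τ`
  have hsecond : Polynomial.C (c 2 0) * Y₁ ^ 2 * y 0 ^ 2 + π *
      (Polynomial.C (c 0 1) * (π * Z) * y 0 ^ 3 +
        (Polynomial.C (c 1 1) * Y₁ * (π ^ 2 * Z) + Polynomial.C (c 0 2) * (π ^ 5 * Z ^ 2)) *
          y 0 ^ 2 +
        (Polynomial.C (c 3 0) * Y₁ ^ 3 + Polynomial.C (c 2 1) * Y₁ ^ 2 * Y₂ +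
          Polynomial.C (c 1 2) * Y₁ * Y₂ ^ 2 + Polynomial.C (c 0 3) * Y₂ ^ 3) * y 0 +
        π * (Polynomial.C (c 4 0) * Y₁ ^ 4 + Polynomial.C (c 3 1) * Y₁ ^ 3 * Y₂ +
          Polynomial.C (c 2 2) * Y₁ ^ 2 * Y₂ ^ 2 + Polynomial.C (c 1 3) * Y₁ * Y₂ ^ 3 +
          Polynomial.C (c 0 4) * Y₂ ^ 4)) = 0 := by
    apply mul_left_cancel₀ (pow_ne_zero 2 hπ0)
    rw [mul_zero, ← hy, hYZ]
    ring
  have h2 := congrArg (Polynomial.eval τ) hsecond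
  simp [hπτ, hc20, h0, hY₁, hn, hM, hβ] at h2

/-- If the quartics `(X + n) (X + l) ^ 3` and `(X + n) (X + m) ^ 3` have the same coefficients at
`X` and `X ^ 2`, then `n = l` or `n = m`. -/
theorem eq_or_eq_of_coeffs (h3 : (3 : K) ≠ 0) {l m n : K} (hlm : l ≠ m)
    (h2 : 3 * l * (l + n) = 3 * m * (m + n)) (h1 : l ^ 2 * (l + 3 * n) = m ^ 2 * (m + 3 * n)) :
    n = l ∨ n = m := by
  have hn : n = -(l + m) := by
    have h : 3 * ((l - m) * (l + m + n)) = 0 := by linear_combination h2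
    have := ((mul_eq_zero.1 ((mul_eq_zero.1 h).resolve_left h3)).resolve_left
      (sub_ne_zero.2 hlm))
    linear_combination this
  have h : (l - m) * ((2 * l + m) * (l + 2 * m)) = 0 := by
    rw [hn] at h1
    linear_combination -h1
  rcases mul_eq_zero.1 ((mul_eq_zero.1 h).resolve_left (sub_ne_zero.2 hlm)) with h | h
  · left; linear_combination hn - h
  · right; linear_combination hn - h

theorem coeffs_affine_mul_cube (n₁ n₀ l₁ l₀ : K) :
    let p := (Polynomial.C n₁ * Polynomial.X + Polynomial.C n₀) *
      (Polynomial.C l₁ * Polynomial.X + Polynomial.C l₀) ^ 3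
    p.coeff 1 = l₀ ^ 2 * (n₁ * l₀ + 3 * n₀ * l₁) ∧
      p.coeff 2 = 3 * l₀ * l₁ * (n₁ * l₀ + n₀ * l₁) ∧ p.coeff 4 = n₁ * l₁ ^ 3 := by
  intro p
  have hp : p = Polynomial.C (n₁ * l₁ ^ 3) * Polynomial.X ^ 4 +
      Polynomial.C (3 * n₁ * l₁ ^ 2 * l₀ + n₀ * l₁ ^ 3) * Polynomial.X ^ 3 +
      Polynomial.C (3 * l₀ * l₁ * (n₁ * l₀ + n₀ * l₁)) * Polynomial.X ^ 2 +
      Polynomial.C (l₀ ^ 2 * (n₁ * l₀ + 3 * n₀ * l₁)) * Polynomial.X +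
      Polynomial.C (n₀ * l₀ ^ 3) := by
    simp only [p, map_mul, map_add, map_pow, map_ofNat]
    ring
  rw [hp]
  simp only [Polynomial.coeff_add, Polynomial.coeff_C_mul, Polynomial.coeff_X_pow,
    Polynomial.coeff_X, Polynomial.coeff_C]
  norm_num

theorem eq_C_mul_X_sub_C {a b : K} (ha : a ≠ 0) :
    (Polynomial.C a * Polynomial.X + Polynomial.C b : Polynomial K) =
      Polynomial.C a * (Polynomial.X - Polynomial.C (-(b / a))) := by
  rw [map_neg, sub_neg_eq_add, mul_add, ← map_mul, mul_div_cancel₀ _ ha]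

/-- The pencil `N L ^ 3, N M ^ 3` of a second Galois point cannot lie in the net of quartics
spanned by `1`, `X ^ 3` and a polynomial of degree four, of which `k₁, k₂, k₄` are the
coefficients at `X`, `X ^ 2` and `X ^ 4`. -/
theorem false_of_cubes (h3 : (3 : K) ≠ 0) {c : ℕ → ℕ → K} (hc00 : c 0 0 = 0) (hc10 : c 1 0 = 0)
    (hc01 : c 0 1 ≠ 0) (hc20 : c 2 0 ≠ 0) {y : Fin 3 → Polynomial K}
    (hy : aeval y (quartic c) = 0) (hbase : ∀ τ, ∃ j, (y j).eval τ ≠ 0)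
    {k₁ k₂ k₄ : K} (hk : k₄ ≠ 0) (hdeg : ∀ j, (y j).natDegree ≤ 4)
    (hy1 : ∀ j, (y j).coeff 1 * k₄ = (y j).coeff 4 * k₁)
    (hy2 : ∀ j, (y j).coeff 2 * k₄ = (y j).coeff 4 * k₂)
    (hne : (y 1).coeff 4 ≠ 0 ∨ (y 2).coeff 4 ≠ 0) {α β γ δ : K} (hdet : α * δ - β * γ ≠ 0)
    {L M N : Polynomial K} (hcop : IsCoprime L M) (hmax : max L.natDegree M.natDegree = 1)
    (hl : y 1 = N * (Polynomial.C α * L ^ 3 + Polynomial.C β * M ^ 3))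
    (hm : y 2 = N * (Polynomial.C γ * L ^ 3 + Polynomial.C δ * M ^ 3)) : False := by
  obtain ⟨D, hD⟩ : ∃ D, D = (α * δ - β * γ)⁻¹ := ⟨_, rfl⟩
  have hD1 : Polynomial.C D * (Polynomial.C α * Polynomial.C δ -
      Polynomial.C β * Polynomial.C γ) = 1 := by
    rw [← map_mul, ← map_mul, ← map_sub, ← map_mul, hD, inv_mul_cancel₀ hdet, map_one]
  have hL : N * L ^ 3 = Polynomial.C (D * δ) * y 1 + Polynomial.C (-(D * β)) * y 2 := by
    rw [hl, hm]
    simp only [map_mul, map_neg]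
    linear_combination (-(N * L ^ 3)) * hD1
  have hM : N * M ^ 3 = Polynomial.C (-(D * γ)) * y 1 + Polynomial.C (D * α) * y 2 := by
    rw [hl, hm]
    simp only [map_mul, map_neg]
    linear_combination (-(N * M ^ 3)) * hD1
  have hcomb : ∀ (p : Polynomial K) (r s : K), p = Polynomial.C r * y 1 + Polynomial.C s * y 2 →
      p.natDegree ≤ 4 ∧ p.coeff 1 * k₄ = p.coeff 4 * k₁ ∧ p.coeff 2 * k₄ = p.coeff 4 * k₂ := by
    rintro p r s rfl
    refine ⟨Polynomial.natDegree_add_le_of_degree_le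
      ((Polynomial.natDegree_C_mul_le _ _).trans (hdeg 1))
      ((Polynomial.natDegree_C_mul_le _ _).trans (hdeg 2)), ?_, ?_⟩
    · simp only [Polynomial.coeff_add, Polynomial.coeff_C_mul]
      linear_combination r * hy1 1 + s * hy1 2
    · simp only [Polynomial.coeff_add, Polynomial.coeff_C_mul]
      linear_combination r * hy2 1 + s * hy2 2
  obtain ⟨hLd, hL1, hL2⟩ := hcomb _ _ _ hL
  obtain ⟨hMd, hM1, hM2⟩ := hcomb _ _ _ hM
  have hN0 : N ≠ 0 := by
    rintro rfl
    rw [zero_mul] at hl hm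
    simp [hl, hm] at hne
  have hLle := le_of_max_le_left hmax.le
  have hMle := le_of_max_le_right hmax.le
  have hpowdeg : ∀ p : Polynomial K, p.natDegree = 1 → (N * p ^ 3).natDegree = N.natDegree + 3 := by
    intro p hp
    have hp0 : p ≠ 0 := by rintro rfl; simp at hp
    rw [Polynomial.natDegree_mul hN0 (pow_ne_zero 3 hp0), Polynomial.natDegree_pow, hp]
  have hNle : N.natDegree ≤ 1 := by
    rcases max_choice L.natDegree M.natDegree with h | h
    · have := hpowdeg L (by omega)
      omega
    · have := hpowdeg M (by omega)
      omega
  obtain ⟨n₁, n₀, hN⟩ := Polynomial.exists_eq_X_add_C_of_natDegree_le_one hNle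
  obtain ⟨l₁, l₀, hL'⟩ := Polynomial.exists_eq_X_add_C_of_natDegree_le_one hLle
  obtain ⟨m₁, m₀, hM'⟩ := Polynomial.exists_eq_X_add_C_of_natDegree_le_one hMle
  obtain ⟨eL1, eL2, eL4⟩ := coeffs_affine_mul_cube n₁ n₀ l₁ l₀
  obtain ⟨eM1, eM2, eM4⟩ := coeffs_affine_mul_cube n₁ n₀ m₁ m₀
  rw [← hN, ← hL'] at eL1 eL2 eL4
  rw [← hN, ← hM'] at eM1 eM2 eM4
  -- for constant `N` both members of the pencil have degree at most three
  have hn₁ : n₁ ≠ 0 := by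
    intro h
    rw [h, zero_mul] at eL4 eM4
    have e1 : (y 1).coeff 4 = 0 := by
      have : y 1 = Polynomial.C α * (N * L ^ 3) + Polynomial.C β * (N * M ^ 3) := by rw [hl]; ring
      rw [this, Polynomial.coeff_add, Polynomial.coeff_C_mul, Polynomial.coeff_C_mul, eL4, eM4]
      simp
    have e2 : (y 2).coeff 4 = 0 := by
      have : y 2 = Polynomial.C γ * (N * L ^ 3) + Polynomial.C δ * (N * M ^ 3) := by rw [hm]; ring
      rw [this, Polynomial.coeff_add, Polynomial.coeff_C_mul, Polynomial.coeff_C_mul, eL4, eM4]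
      simp
    exact hne.elim (fun h => h e1) (fun h => h e2)
  rw [eL1, eL4] at hL1
  rw [eL2, eL4] at hL2
  rw [eM1, eM4] at hM1
  rw [eM2, eM4] at hM2
  have hlead : ∀ a₁ a₀ : K, a₀ ^ 2 * (n₁ * a₀ + 3 * n₀ * a₁) * k₄ = n₁ * a₁ ^ 3 * k₁ →
      a₁ = 0 → a₀ = 0 := by
    rintro a₁ a₀ h rfl
    have : n₁ * k₄ * a₀ ^ 3 = 0 := by linear_combination h
    simpa [hn₁, hk] using this
  have hl₁ : l₁ ≠ 0 := by
    intro h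
    have h0 := hlead l₁ l₀ hL1 h
    rw [h, h0] at hL'
    have hL0 : L = 0 := by rw [hL']; simp
    rw [hL0, isCoprime_zero_left] at hcop
    rw [hL0, Polynomial.natDegree_eq_zero_of_isUnit hcop] at hmax
    simp at hmax
  have hm₁ : m₁ ≠ 0 := by
    intro h
    have h0 := hlead m₁ m₀ hM1 h
    rw [h, h0] at hM'
    have hM0 : M = 0 := by rw [hM']; simp
    rw [hM0, isCoprime_zero_right] at hcop
    rw [hM0, Polynomial.natDegree_eq_zero_of_isUnit hcop] at hmax
    simp at hmax
  have hcoproot : ∀ τ, L.eval τ = 0 → M.eval τ ≠ 0 := by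
    intro τ h1 h2
    obtain ⟨r, s, hrs⟩ := hcop
    have := congrArg (Polynomial.eval τ) hrs
    simp [h1, h2] at this
  obtain ⟨l, hl'⟩ : ∃ l, l = l₀ / l₁ := ⟨_, rfl⟩
  obtain ⟨m, hm'⟩ : ∃ m, m = m₀ / m₁ := ⟨_, rfl⟩
  obtain ⟨n, hn'⟩ : ∃ n, n = n₀ / n₁ := ⟨_, rfl⟩
  have el : l₀ = l₁ * l := by rw [hl']; field_simp
  have em : m₀ = m₁ * m := by rw [hm']; field_simp
  have en : n₀ = n₁ * n := by rw [hn']; field_simp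
  rw [eq_C_mul_X_sub_C hl₁, ← hl'] at hL'
  rw [eq_C_mul_X_sub_C hm₁, ← hm'] at hM'
  rw [eq_C_mul_X_sub_C hn₁, ← hn'] at hN
  have hlm : l ≠ m := by
    rintro rfl
    exact hcoproot (-l) (by simp [hL']) (by simp [hM'])
  have hcancel : ∀ a f g : K, a ≠ 0 → n₁ * a ^ 3 * f * k₄ = n₁ * a ^ 3 * g → f * k₄ = g := by
    intro a f g ha h
    apply mul_left_cancel₀ (mul_ne_zero hn₁ (pow_ne_zero 3 ha))
    linear_combination h
  have q1 := hcancel l₁ (l ^ 2 * (l + 3 * n)) k₁ hl₁ (by rw [el, en] at hL1; linear_combination hL1)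
  have q2 := hcancel l₁ (3 * l * (l + n)) k₂ hl₁ (by rw [el, en] at hL2; linear_combination hL2)
  have q3 := hcancel m₁ (m ^ 2 * (m + 3 * n)) k₁ hm₁ (by rw [em, en] at hM1; linear_combination hM1)
  have q4 := hcancel m₁ (3 * m * (m + n)) k₂ hm₁ (by rw [em, en] at hM2; linear_combination hM2)
  rcases eq_or_eq_of_coeffs h3 hlm (mul_right_cancel₀ hk (q2.trans q4.symm))
    (mul_right_cancel₀ hk (q1.trans q3.symm)) with h | h
  · rw [h] at hN
    refine false_of_common_root hc00 hc10 hc01 hc20 hy (hbase (-l))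
      (hcoproot (-l) (by simp [hL'])) (n := n₁) (l := l₁) hn₁ hdet ?_ ?_
    · rw [hl, ← hN, ← hL']
    · rw [hm, ← hN, ← hL']
  · rw [h] at hN
    refine false_of_common_root (α := β) (β := α) (γ := δ) (δ := γ) hc00 hc10 hc01 hc20 hy
      (hbase (-m)) (M := L) (fun h0 => hcoproot (-m) h0 (by simp [hM'])) (n := n₁) (l := m₁) hn₁
      (fun h0 => hdet (by linear_combination -h0)) ?_ ?_
    · rw [hl, ← hN, ← hM']; ring
    · rw [hm, ← hN, ← hM']; ring

/-- A rational quartic curve with a Galois point `P` at which the tangent line meets it four times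
has no smooth Galois point at which the tangent line meets it exactly twice. -/
theorem no_second_galois_point [IsAlgClosed K] (h3 : (3 : K) ≠ 0) (Q : PlaneCurve K 4)
    (hQ : Q.IsRational) {P P' : ℙ K (Fin 3 → K)} (hP : Q.IsSmoothPoint P) (hPG : Q.IsGaloisPoint P)
    (hPm : Q.tangentMultiplicity P = 4) (hP' : Q.IsSmoothPoint P') (hPG' : Q.IsGaloisPoint P')
    (hPm' : Q.tangentMultiplicity P' = 2) : False := by
  obtain ⟨e⟩ := hQ
  obtain ⟨x₀, hx₀, hproj⟩ := Q.exists_isGenericPoint (by norm_num)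
  have hg₀ : IsGalois (projField x₀ P.rep) Q.functionField := by rw [hproj]; exact hPG.2
  have hg₀' : IsGalois (projField x₀ P'.rep) Q.functionField := by rw [hproj]; exact hPG'.2
  have hx := hx₀.map e
  have hg := isGalois_projField_map e x₀ P.rep
  have hg' := isGalois_projField_map e x₀ P'.rep
  obtain ⟨A, B, c, hAB, hBA, hA, hc, hc00, hc10, hc01, hmult⟩ := exists_adapted_coordinates Q P hP
  obtain ⟨hc20, hc30, hc40⟩ := coeffs_of_emultiplicity_eq_four (hmult.symm.trans hPm)
  obtain ⟨θ, s, a, b, q, hs, hq, hθ⟩ :=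
    exists_parametrization h3 hx hAB hBA hA hc hc00 hc10 hc01 hc20 hc30 hc40
  obtain ⟨p, hp⟩ : ∃ p, p = A.map Polynomial.C *ᵥ
    ![q, Polynomial.C a * Polynomial.X ^ 3 + Polynomial.C b, 1] := ⟨_, rfl⟩
  rw [← hp] at hθ
  have hscale : (fun i => s⁻¹ * θ (e (x₀ i))) =
      fun i => algebraMap (Polynomial K) (RatFunc K) (p i) := by
    funext i
    rw [hθ i, inv_mul_cancel_left₀ hs]
  have hx₁ := (hx.map θ).mul_left Q.isHomogeneous (inv_ne_zero hs)
  have hg₁ := isGalois_projField_map θ (fun i => e (x₀ i)) P'.rep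
  rw [← projField_mul_left _ _ (inv_ne_zero hs), hscale] at hg₁
  rw [hscale] at hx₁
  obtain ⟨A', B', c', hAB', hBA', hA', hc', hc00', hc10', hc01', hmult'⟩ :=
    exists_adapted_coordinates Q P' hP'
  have hc20' := coeff_ne_zero_of_emultiplicity_eq_two (hmult'.symm.trans hPm')
  obtain ⟨y, hy⟩ : ∃ y, y = B'.map Polynomial.C *ᵥ p := ⟨_, rfl⟩
  have hyx : (fun i => algebraMap (Polynomial K) (RatFunc K) (y i)) =
      B'.map (algebraMap K (RatFunc K)) *ᵥ fun i => algebraMap _ _ (p i) := by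
    funext i
    rw [hy]
    simp [Matrix.mulVec, dotProduct]
  have hgen : IsGenericPoint (quartic c') fun i => algebraMap (Polynomial K) (RatFunc K) (y i) := by
    rw [hyx, ← hc']; exact hx₁.linSubst hAB' hBA'
  have hy2 := ne_zero_of_isGenericPoint hc00' hc10' hc01' hgen
  have hfr := finrank_adjoin_eq_three hc00' hc10' hc01' hgen
  rw [projField_eq_adjoin hAB' hBA' hA' hyx hy2] at hg₁
  obtain ⟨θ', α, β, γ, δ, hdet, hmoeb⟩ := RatFunc.exists_algEquiv_eq_cube_moebius h3 _ hfr
  have hmoeb' := congrArg θ'.symm hmoeb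
  simp only [map_add, map_mul, map_pow, RatFunc.algEquiv_C, AlgEquiv.symm_apply_apply] at hmoeb'
  obtain ⟨L, M, N, hcop, hmax, hl, hm⟩ := exists_cubes (fun h => hy2 (by rw [h, map_zero]))
    (RatFunc.adjoin_algEquiv_X θ'.symm) hdet hmoeb'
  have hy0 : aeval y (quartic c') = 0 := by
    apply RatFunc.algebraMap_injective K
    rw [map_zero, ← hgen.aeval_eq_zero]
    exact comp_aeval_apply y (IsScalarTower.toAlgHom K (Polynomial K) (RatFunc K)) (quartic c')
  -- the coordinates of the second point lie in the net spanned by `q`, `X ^ 3` and `1`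
  obtain ⟨G, hG⟩ : ∃ G, G = B' * A := ⟨_, rfl⟩
  have hyG : ∀ j, y j = Polynomial.C (G j 0) * q + Polynomial.C (G j 1) *
      (Polynomial.C a * Polynomial.X ^ 3 + Polynomial.C b) + Polynomial.C (G j 2) := by
    intro j
    rw [hy, hp, Matrix.mulVec_mulVec, ← Matrix.map_mul, ← hG]
    simp [Matrix.mulVec, dotProduct, Fin.sum_univ_three]
  have hcoeff : ∀ j, (y j).coeff 1 = G j 0 * q.coeff 1 ∧ (y j).coeff 2 = G j 0 * q.coeff 2 ∧
      (y j).coeff 4 = G j 0 * q.coeff 4 := by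
    intro j
    rw [hyG]
    simp [Polynomial.coeff_X_pow]
  have hq4 : q.coeff 4 ≠ 0 := by
    rw [← hq, Polynomial.coeff_natDegree, Polynomial.leadingCoeff_ne_zero]
    rintro rfl
    simp at hq
  refine false_of_cubes h3 hc00' hc10' hc01' hc20' hy0 ?_ (k₁ := q.coeff 1) (k₂ := q.coeff 2) hq4
    ?_ ?_ ?_ ?_ hdet hcop hmax hl hm
  -- the parametrization has no base point, as its last coordinate in the frame of `P` is `1`
  · intro τ
    by_contra! h
    have h1 : (B * A').map Polynomial.C *ᵥ y =
        ![q, Polynomial.C a * Polynomial.X ^ 3 + Polynomial.C b, 1] := by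
      rw [hy, hp, Matrix.mulVec_mulVec, Matrix.mulVec_mulVec, ← Matrix.map_mul, ← Matrix.map_mul,
        show B * A' * B' * A = 1 by rw [mul_assoc B, hAB', mul_one, hBA],
        Matrix.map_one _ (map_zero _) (map_one _), Matrix.one_mulVec]
    have h2 := congrArg (Polynomial.eval τ) (congrFun h1 2)
    simp [Matrix.mulVec, dotProduct, Fin.sum_univ_three, h] at h2
  · intro j
    rw [hyG]
    refine Polynomial.natDegree_add_le_of_degree_le (Polynomial.natDegree_add_le_of_degree_le
      ((Polynomial.natDegree_C_mul_le _ _).trans hq.le) ?_) ?_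
    · compute_degree
      norm_num
    · simp
  · intro j
    rw [(hcoeff j).1, (hcoeff j).2.2]; ring
  · intro j
    rw [(hcoeff j).2.1, (hcoeff j).2.2]; ring
  -- if both coefficients vanish, then the two projections have the same centre
  · rw [(hcoeff 1).2.2, (hcoeff 2).2.2]
    by_contra! h
    have hG1 : G 1 0 = 0 := (mul_eq_zero.1 h.1).resolve_right hq4
    have hG2 : G 2 0 = 0 := (mul_eq_zero.1 h.2).resolve_right hq4
    have hcol : ∀ i, P.rep i = G 0 0 * P'.rep i := by
      intro i
      have : (A' * G) i 0 = A i 0 := by rw [hG, ← mul_assoc, hAB', one_mul]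
      rw [Matrix.mul_apply, Fin.sum_univ_three, hG1, hG2, hA, hA'] at this
      rw [← this]; ring
    have hG0 : G 0 0 ≠ 0 := by
      intro h0
      apply P.rep_nonzero
      funext i
      rw [hcol i, h0, zero_mul]; rfl
    have hPP : P = P' := by
      rw [← P.mk_rep, ← P'.mk_rep, Projectivization.mk_eq_mk_iff']
      exact ⟨G 0 0, by funext i; rw [hcol i]; rfl⟩
    rw [hPP, hPm'] at hPm
    exact absurd hPm (by decide)

end PlaneCurve

end

theorem proposition2 {K : Type*} [Field K] [IsAlgClosed K] (p : ℕ) [CharP K p]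
    (hp2 : p ≠ 2) (hp3 : p ≠ 3) :
    ¬ ∃ C : PlaneCurve K 4, C.IsRational ∧ 1 ≤ C.deltaZero ∧ 1 ≤ C.deltaTwo := by
  rintro ⟨C, hC, h0, h2⟩
  have h3 : (3 : K) ≠ 0 := by
    intro h
    have hdvd : p ∣ 3 := (CharP.cast_eq_zero_iff K p 3).1 (by exact_mod_cast h)
    rcases (Nat.dvd_prime Nat.prime_three).1 hdvd with h1 | h1
    · exact CharP.char_ne_one K p h1
    · exact hp3 h1
  obtain ⟨P', hP', hG', hm'⟩ := Set.one_le_encard_iff_nonempty.1 h0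
  obtain ⟨P, hP, hG, hm⟩ := Set.one_le_encard_iff_nonempty.1 h2
  exact C.no_second_galois_point h3 hC hP hG hm hP' hG' hm'
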